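/- **Causal model and causal variational inequality.** Consider a probabilistic structural causal model: exogenous variables $u$ with a probability distribution $P$, and endogenous variables $(V_i)$ given by structural equations $V_i = f_i(u,(V_j)_{j\ne i})$, such that every submodel (obtained by replacing the equations of some variables by constants) has exactly one solution for each $u$, depending measurably on $u$. Let $\hat w$ be an intervention, i.e. some of the endogenous variables are set to fixed non-random values, and let $P_w$ be the joint law of all (exogenous and endogenous) variables in the resulting submodel. Let $K_1,\dots,K_m\subseteq\mathbb R^n$ be closed convex sets with $K=\bigcap_{i=1}^m K_i\neq\emptyset$, and let $F(x,\eta)\in\mathbb R^n$ ($x\in\mathbb R^n$, $\eta$ a joint value of the variables of the causal model) be continuous in $x$ for every $\eta$ and measurable in $\eta$ for every $x$. Assume that $F(x,\cdot)$ is $P_w$-integrable for every $x$, and let $F_w(x)=E_w[F(x,\eta)]$ be the expectation with respect to $P_w$. A solution of the intervened problem $\mathrm{CVI}(F_w,K)$ is a point $x^*\in K$ with $$\langle F_w(x^*),y-x^*\rangle\ge 0\qquad\text{for all } y\in K .$$ **Algorithm.** Let $P_C$ denote the Euclidean projection onto $C$. Let $x_0$ be a random vector in $\mathbb R^n$, let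 $v_0,v_1,\dots$ be random values of $\eta$, and let $w_0,w_1,\dots$ be random indices in $\{1,\dots,m\}$, all on one probability space. For $k\ge 0$ put $$z_k=x_k-\alpha_kF(x_k,v_k),\qquad x_{k+1}=z_k-\beta_k\,(z_k-P_{K_{w_k}}z_k),$$ and let $\mathcal F_k=\sigma(v_0,\dots,v_{k-1},w_0,\dots,w_{k-1},z_0,\dots,z_{k-1},x_0,\dots,x_k)$. **Assumptions.** 1. $F_w$ is strongly monotone on $K$: there is $\mu>0$ with $\langle F_w(x)-F_w(y),x-y\rangle\ge\mu\|x-y\|^2$ for all $x,y\in K$; and the sampled mapping is stochastically Lipschitz: there is $L>0$ such that for all $k\ge0$ and all $x,y\in\mathbb R^n$, $\|F(x,v_k)-F(y,v_k)\|^2$ is integrable and $E[\|F(x,v_k)-F(y,v_k)\|^2\mid\mathcal F_k]\le L^2\|x-y\|^2$ almost surely. 2. For a solution $x^*$ of $\mathrm{CVI}(F_w,K)$ there is $B>0$ such that $\|F_w(x^*)\|\le B$ and, for all $k\ge0$, $\|F(x^*,v_k)\|^2$ is integrable and $E[\|F(x^*,v_k)\|^2\mid\mathcal F_k]\le B^2$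 almost surely. 3. The constraints are linearly regular: there is $\eta_0>0$ with $\|x-P_Kx\|^2\le\eta_0\max_{1\le i\le m}\|x-P_{K_i}x\|^2$ for all $x\in\mathbb R^n$. 4. The step sizes are deterministic with $\alpha_k>0$, $0<\beta_k<2$, $\sum_k\alpha_k=\infty$, $\sum_k\alpha_k^2<\infty$ and $\sum_k\alpha_k^2/\gamma_k<\infty$, where $\gamma_k=\beta_k(2-\beta_k)$. 5. There is $\rho\in(0,1]$ such that $P(w_k=i\mid\mathcal F_k)\ge\rho/m$ almost surely for all $k\ge0$ and $i=1,\dots,m$; and for all $k\ge 0$ and $x\in\mathbb R^n$, $F(x,v_k)$ is integrable and $E[F(x,v_k)\mid\mathcal F_k]=F_w(x)$ almost surely. **Conclusion.** The intervened problem $\mathrm{CVI}(F_w,K)$ has exactly one solution $x^*$, and the iterates $x_k$ converge to $x^*$ almost surely. -/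

import Mathlib

open MeasureTheory Filter Topology
open scoped RealInnerProductSpace

noncomputable section

/-! ## Metric projection -/

/-- The metric projection of `x` onto a set `C` of `ℝⁿ`: a point of `C` nearest to `x`
(it exists and is unique when `C` is nonempty, closed and convex; see `proj_spec`, `proj_unique`). -/
def proj {n : ℕ} (C : Set (EuclideanSpace ℝ (Fin n))) (x : EuclideanSpace ℝ (Fin n)) :
    EuclideanSpace ℝ (Fin n) :=
  Classical.epsilon fun y => y ∈ C ∧ ∀ z ∈ C, ‖x - y‖ ≤ ‖x - z‖

theorem proj_spec {n : ℕ} {C : Set (EuclideanSpace ℝ (Fin n))} (hne : C.Nonempty)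
    (hcl : IsClosed C) (x : EuclideanSpace ℝ (Fin n)) :
    proj C x ∈ C ∧ ∀ z ∈ C, ‖x - proj C x‖ ≤ ‖x - z‖ := by
  have h : ∃ y, y ∈ C ∧ ∀ z ∈ C, ‖x - y‖ ≤ ‖x - z‖ := by
    obtain ⟨y, hy, hxy⟩ := hcl.exists_infDist_eq_dist hne x
    refine ⟨y, hy, fun z hz => ?_⟩
    rw [← dist_eq_norm, ← dist_eq_norm, ← hxy]
    exact Metric.infDist_le_dist_of_mem hz
  exact Classical.epsilon_spec h

theorem proj_unique {n : ℕ} {C : Set (EuclideanSpace ℝ (Fin n))} (hne : C.Nonempty)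
    (hcl : IsClosed C) (hcv : Convex ℝ C) (x y : EuclideanSpace ℝ (Fin n))
    (hy : y ∈ C) (hmin : ∀ z ∈ C, ‖x - y‖ ≤ ‖x - z‖) : y = proj C x := by
  obtain ⟨hp, hpm⟩ := proj_spec hne hcl x
  have h1 : ‖x - y‖ = ‖x - proj C x‖ := le_antisymm (hmin _ hp) (hpm _ hy)
  have hm : (1 / 2 : ℝ) • y + (1 / 2 : ℝ) • proj C x ∈ C :=
    hcv hy hp (by norm_num) (by norm_num) (by norm_num)
  have h2 := hmin _ hm
  have h3 := parallelogram_law_with_norm ℝ (x - y) (x - proj C x)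
  have h4 : (x - y) + (x - proj C x)
      = (2 : ℝ) • (x - ((1 / 2 : ℝ) • y + (1 / 2 : ℝ) • proj C x)) := by
    module
  rw [h4, norm_smul, ← h1] at h3
  norm_num at h3
  have h5 : ‖proj C x - y‖ = 0 := by
    nlinarith [norm_nonneg (proj C x - y), norm_nonneg (x - y)]
  exact (sub_eq_zero.mp (norm_eq_zero.mp h5)).symm

/-! ## Structural causal models and interventions -/

/-- An intervention: it sets some of the endogenous variables to fixed (non-random) values
(`some c`) and leaves the others untouched (`none`). -/
abbrev Intervention {ι : Type*} (R : ι → Type*) := ∀ i, Option (R i)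

/-- `v` solves the structural equations `vᵢ = eqnᵢ(u, (vⱼ)_{j ≠ i})` of the submodel in which the
equations of the variables set by `a` have been replaced by `vᵢ = c`. -/
def SolvesSubmodel {ι : Type*} {R : ι → Type*} {U : Type*}
    (eqn : ∀ i, U → (∀ j : {j : ι // j ≠ i}, R j) → R i) (a : Intervention R)
    (u : U) (v : ∀ i, R i) : Prop :=
  ∀ i, v i = (a i).getD (eqn i u fun j => v j)

/-- A probabilistic structural causal model with exogenous space `U`, and endogenous variables
indexed by `ι` with ranges `R i`. As usual, every submodel has, for each value of the exogenous
variables, exactly one solution, which depends measurably on that value. -/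
structure CausalModel (ι : Type*) (R : ι → Type*) (U : Type*)
    [∀ i, MeasurableSpace (R i)] [MeasurableSpace U] where
  /-- The distribution of the exogenous variables. -/
  law : Measure U
  isProbabilityMeasure_law : IsProbabilityMeasure law
  /-- The structural equations. -/
  eqn : ∀ i, U → (∀ j : {j : ι // j ≠ i}, R j) → R i
  exists_response : ∀ a : Intervention R, ∃ s : U → ∀ i, R i,
    Measurable s ∧ ∀ u v, SolvesSubmodel eqn a u v ↔ v = s u

namespace CausalModel

variable {ι : Type*} {R : ι → Type*} {U : Type*} [∀ i, MeasurableSpace (R i)] [MeasurableSpace U]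

/-- The values of the endogenous variables in the submodel given by `a`. -/
def response (M : CausalModel ι R U) (a : Intervention R) : U → ∀ i, R i :=
  (M.exists_response a).choose

/-- The intervention distribution `P_a`: the joint law of all variables in the submodel. -/
def interventionLaw (M : CausalModel ι R U) (a : Intervention R) : Measure (U × ∀ i, R i) :=
  M.law.map fun u => (u, M.response a u)

end CausalModel

/-! ## Causal variational inequalities -/

/-- A finite-dimensional causal variational inequality model `CVI(F, K)`, with feasible set
`K = ⋂ᵢ Kᵢ ≠ ∅` for closed convex sets `K₁, …, K_m ⊆ ℝⁿ` and a mapping `F(x, η)`, continuous in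
`x` and measurable in `η`, where `η` is the joint value of the variables of a causal model. -/
structure CausalVI (n m : ℕ) (ι : Type*) (R : ι → Type*) (U : Type*)
    [∀ i, MeasurableSpace (R i)] [MeasurableSpace U] where
  model : CausalModel ι R U
  field : EuclideanSpace ℝ (Fin n) → (U × ∀ i, R i) → EuclideanSpace ℝ (Fin n)
  continuous_field : ∀ η, Continuous fun x => field x η
  measurable_field : ∀ x, Measurable (field x)
  constraint : Fin m → Set (EuclideanSpace ℝ (Fin n))
  isClosed_constraint : ∀ i, IsClosed (constraint i)
  convex_constraint : ∀ i, Convex ℝ (constraint i)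
  nonempty_feasible : (⋂ i, constraint i).Nonempty

namespace CausalVI

variable {n m : ℕ} {ι : Type*} {R : ι → Type*} {U : Type*}
  [∀ i, MeasurableSpace (R i)] [MeasurableSpace U]

/-- The feasible set `K`. -/
def feasible (M : CausalVI n m ι R U) : Set (EuclideanSpace ℝ (Fin n)) :=
  ⋂ i, M.constraint i

/-- The intervened mapping `F_a(x) = E_a[F(x, η)]`. -/
def meanField (M : CausalVI n m ι R U) (a : Intervention R) (x : EuclideanSpace ℝ (Fin n)) :
    EuclideanSpace ℝ (Fin n) :=
  ∫ η, M.field x η ∂(M.model.interventionLaw a)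

/-- The expectation defining the intervened mapping exists at every point. -/
def HasMeanField (M : CausalVI n m ι R U) (a : Intervention R) : Prop :=
  ∀ x, Integrable (M.field x) (M.model.interventionLaw a)

/-- `x` solves the intervened problem `CVI(F_a, K)`. -/
def IsSolution (M : CausalVI n m ι R U) (a : Intervention R) (x : EuclideanSpace ℝ (Fin n)) :
    Prop :=
  x ∈ M.feasible ∧ ∀ y ∈ M.feasible, 0 ≤ ⟪M.meanField a x, y - x⟫

/-- The intervened mapping is strongly monotone on `K`. -/
def StronglyMonotone (M : CausalVI n m ι R U) (a : Intervention R) : Prop :=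
  ∃ μ : ℝ, 0 < μ ∧ ∀ x ∈ M.feasible, ∀ y ∈ M.feasible,
    μ * ‖x - y‖ ^ 2 ≤ ⟪M.meanField a x - M.meanField a y, x - y⟫

/-- Linear regularity of the constraints:
`‖x - P_K x‖² ≤ η maxᵢ ‖x - P_{Kᵢ} x‖²` for all `x ∈ ℝⁿ`. -/
def LinearlyRegular (M : CausalVI n m ι R U) : Prop :=
  ∃ η : ℝ, 0 < η ∧ ∀ x : EuclideanSpace ℝ (Fin n),
    ‖x - proj M.feasible x‖ ^ 2 ≤ η * ⨆ i, ‖x - proj (M.constraint i) x‖ ^ 2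

/-! ## The two-step algorithm -/

section Algorithm

variable {Ω : Type*}

/-- The gradient-like half step `z_k = x_k - α_k F(x_k, v_k)`, given `x_k`. -/
def halfStep (M : CausalVI n m ι R U) (α : ℕ → ℝ) (v : ℕ → Ω → U × ∀ i, R i) (k : ℕ)
    (x : EuclideanSpace ℝ (Fin n)) (ω : Ω) : EuclideanSpace ℝ (Fin n) :=
  x - α k • M.field x (v k ω)

/-- The iterates `x_k` of the two-step algorithm: `x_{k+1} = z_k - β_k (z_k - P_{w_k} z_k)`, where
`P_{w_k}` is the projection onto the sampled constraint set `K_{w_k}`. -/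
def iterate (M : CausalVI n m ι R U) (α β : ℕ → ℝ) (v : ℕ → Ω → U × ∀ i, R i)
    (w : ℕ → Ω → Fin m) (x₀ : Ω → EuclideanSpace ℝ (Fin n)) :
    ℕ → Ω → EuclideanSpace ℝ (Fin n)
  | 0, ω => x₀ ω
  | k + 1, ω =>
    let z := M.halfStep α v k (M.iterate α β v w x₀ k ω) ω
    z - β k • (z - proj (M.constraint (w k ω)) z)

/-- The intermediate points `z_k` of the two-step algorithm. -/
def intermediate (M : CausalVI n m ι R U) (α β : ℕ → ℝ) (v : ℕ → Ω → U × ∀ i, R i)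
    (w : ℕ → Ω → Fin m) (x₀ : Ω → EuclideanSpace ℝ (Fin n)) (k : ℕ) (ω : Ω) :
    EuclideanSpace ℝ (Fin n) :=
  M.halfStep α v k (M.iterate α β v w x₀ k ω) ω

/-- The history `𝓕_k`: the σ-algebra generated by
`v_0, …, v_{k-1}, w_0, …, w_{k-1}, z_0, …, z_{k-1}, x_0, …, x_k`. -/
@[reducible] def history (M : CausalVI n m ι R U) (α β : ℕ → ℝ) (v : ℕ → Ω → U × ∀ i, R i)
    (w : ℕ → Ω → Fin m) (x₀ : Ω → EuclideanSpace ℝ (Fin n)) (k : ℕ) : MeasurableSpace Ω :=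
  (⨆ (j : ℕ) (_ : j < k), MeasurableSpace.comap (v j) inferInstance) ⊔
  (⨆ (j : ℕ) (_ : j < k), MeasurableSpace.comap (w j) inferInstance) ⊔
  (⨆ (j : ℕ) (_ : j < k),
    MeasurableSpace.comap (M.intermediate α β v w x₀ j) inferInstance) ⊔
  (⨆ (j : ℕ) (_ : j ≤ k), MeasurableSpace.comap (M.iterate α β v w x₀ j) inferInstance)

/-- Stochastic Lipschitz continuity of the sampled mapping, relative to the histories `𝓕 k`: the
conditional expectations exist and `E[‖F(x,v_k) - F(y,v_k)‖² | 𝓕_k] ≤ L² ‖x - y‖²` a.s. -/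
def StochasticLipschitz (M : CausalVI n m ι R U) {mΩ : MeasurableSpace Ω} (Pr : Measure Ω)
    (𝓕 : ℕ → MeasurableSpace Ω) (v : ℕ → Ω → U × ∀ i, R i) : Prop :=
  ∃ L : ℝ, 0 < L ∧ ∀ (k : ℕ) (x y : EuclideanSpace ℝ (Fin n)),
    Integrable (fun ω => ‖M.field x (v k ω) - M.field y (v k ω)‖ ^ 2) Pr ∧
    ∀ᵐ ω ∂Pr, (Pr[fun ω' => ‖M.field x (v k ω') - M.field y (v k ω')‖ ^ 2 | 𝓕 k]) ω
      ≤ L ^ 2 * ‖x - y‖ ^ 2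

/-- Boundedness at the solution `x*`: `‖F_a(x*)‖ ≤ B` and `E[‖F(x*, v_k)‖² | 𝓕_k] ≤ B²` a.s. -/
def BoundedAtSolution (M : CausalVI n m ι R U) (a : Intervention R) {mΩ : MeasurableSpace Ω}
    (Pr : Measure Ω) (𝓕 : ℕ → MeasurableSpace Ω) (v : ℕ → Ω → U × ∀ i, R i) : Prop :=
  ∀ xs, M.IsSolution a xs → ∃ B : ℝ, 0 < B ∧ ‖M.meanField a xs‖ ≤ B ∧ ∀ k : ℕ,
    Integrable (fun ω => ‖M.field xs (v k ω)‖ ^ 2) Pr ∧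
    ∀ᵐ ω ∂Pr, (Pr[fun ω' => ‖M.field xs (v k ω')‖ ^ 2 | 𝓕 k]) ω ≤ B ^ 2

/-- Unbiased sampling of the stochastic components: `E[F(x, v_k) | 𝓕_k] = F_a(x)` a.s. -/
def UnbiasedSampling (M : CausalVI n m ι R U) (a : Intervention R) {mΩ : MeasurableSpace Ω}
    (Pr : Measure Ω) (𝓕 : ℕ → MeasurableSpace Ω) (v : ℕ → Ω → U × ∀ i, R i) : Prop :=
  ∀ (k : ℕ) (x : EuclideanSpace ℝ (Fin n)),
    Integrable (fun ω => M.field x (v k ω)) Pr ∧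
    ∀ᵐ ω ∂Pr, (Pr[fun ω' => M.field x (v k ω') | 𝓕 k]) ω = M.meanField a x

end Algorithm

end CausalVI

/-- Sufficient sampling of the constraints: `P(w_k = i | 𝓕_k) ≥ ρ / m` a.s. for all `k` and `i`,
with a constant `ρ ∈ (0, 1]`. -/
def SufficientSampling {Ω : Type*} {mΩ : MeasurableSpace Ω} {m : ℕ} (Pr : Measure Ω)
    (𝓕 : ℕ → MeasurableSpace Ω) (w : ℕ → Ω → Fin m) : Prop :=
  ∃ ρ : ℝ, 0 < ρ ∧ ρ ≤ 1 ∧ ∀ (k : ℕ) (i : Fin m),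
    ∀ᵐ ω ∂Pr, ρ / m ≤ (Pr[{ω' | w k ω' = i}.indicator (fun _ => (1 : ℝ)) | 𝓕 k]) ω

/-- The step-size conditions: `α_k > 0`, `0 < β_k < 2` (so that `γ_k = β_k (2 - β_k) > 0`),
`∑ α_k = ∞`, `∑ α_k² < ∞` and `∑ α_k² / γ_k < ∞`. -/
structure StepSizes (α β : ℕ → ℝ) : Prop where
  α_pos : ∀ k, 0 < α k
  β_pos : ∀ k, 0 < β k
  β_lt_two : ∀ k, β k < 2
  sum_α : Tendsto (fun N => ∑ k ∈ Finset.range N, α k) atTop atTop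
  sum_α_sq : Summable fun k => α k ^ 2
  sum_α_sq_div : Summable fun k => α k ^ 2 / (β k * (2 - β k))

end

/-!
The solution `xs` exists because a projected step `x ↦ P_K (x - t G x)` of the mean field `G` is a
contraction of `K` for small `t`; here `G` is Lipschitz by Jensen's inequality
(`CausalVI.norm_meanField_sub_le`, `exists_variationalInequality_solution`).

For the convergence, put `V k = ‖x k - xs‖ ^ 2` and `γ k = β k * (2 - β k)`, and let `P i` be the
projection onto the `i`-th constraint set. A relaxed projection step contracts towards `xs`, so
`V (k + 1) ≤ V k - 2 α ⟪F(x k, v k), x k - xs⟫ + 2 α² ‖F(x k, v k)‖² - γ/2 ‖x k - P (w k) (x k)‖²`.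
Conditionally on the past, `F(x k, v k)` has mean `G (x k)` and second moment `O(1 + V k)`, while
sufficient sampling and linear regularity turn the last term into a multiple of the squared
distance of `x k` to `K`. Strong monotonicity is only available on `K`: it is used at the projection
of `x k`, and the resulting error, which is linear in the distance to `K`, is absorbed by
the quadratic term at the cost of `O(α²/γ) (1 + V k)`. The outcome (`integral_twoStep_le`) is, in
conditional mean, `V (k + 1) ≤ (1 + a k - θ k) V k + b k` with deterministic coefficients, where `a`
and `b` are combinations of `α²` and `α²/γ`, hence summable, and `θ` is a multiple of `min α γ`,
whose sum diverges because `α ≤ min α γ + α²/γ` (`StepSizes.tendsto_sum_min`). Such a `V` tends to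
`0` almost surely (`ae_tendsto_zero_of_setIntegral_le`).

Two points need care. The hypotheses on the sampled field concern deterministic points, whereas the
estimate needs the random point `x k`; they are carried over by approximating `x k` in `L²` by
functions of the past with finitely many values (`eLpNorm_randomField_sub_le`,
`integral_inner_randomField_comp_eq_zero`). And `x₀` has no moments, so the argument is run on
each of the events `‖x₀‖ ≤ r`, which belong to every history and exhaust the sample space. For both
reasons conditional inequalities are expressed by integrals over events of the past.
-/

noncomputable section

/-! ### Metric projections -/

section Projection

variable {n : ℕ} {C : Set (EuclideanSpace ℝ (Fin n))}

theorem proj_inner_le_zero (hne : C.Nonempty) (hcl : IsClosed C) (hcv : Convex ℝ C)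
    (x : EuclideanSpace ℝ (Fin n)) {z : EuclideanSpace ℝ (Fin n)} (hz : z ∈ C) :
    ⟪x - proj C x, z - proj C x⟫ ≤ 0 := by
  obtain ⟨hp, hmin⟩ := proj_spec hne hcl x
  refine (norm_eq_iInf_iff_real_inner_le_zero hcv hp).1 ?_ z hz
  have : Nonempty C := ⟨⟨_, hp⟩⟩
  refine le_antisymm (le_ciInf fun w => hmin w w.2) ?_
  exact ciInf_le (f := fun w : C => ‖x - w‖) ⟨0, by rintro _ ⟨w, rfl⟩; positivity⟩ ⟨_, hp⟩

theorem norm_proj_sub_proj_le (hne : C.Nonempty) (hcl : IsClosed C) (hcv : Convex ℝ C)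
    (x y : EuclideanSpace ℝ (Fin n)) : ‖proj C x - proj C y‖ ≤ ‖x - y‖ := by
  have h1 := proj_inner_le_zero hne hcl hcv x (proj_spec hne hcl y).1
  have h2 := proj_inner_le_zero hne hcl hcv y (proj_spec hne hcl x).1
  have h3 : ‖proj C x - proj C y‖ ^ 2 ≤ ⟪x - y, proj C x - proj C y⟫ := by
    have h : ⟪x - y, proj C x - proj C y⟫ = ‖proj C x - proj C y‖ ^ 2
        - ⟪x - proj C x, proj C y - proj C x⟫ - ⟪y - proj C y, proj C x - proj C y⟫ := by
      rw [← real_inner_self_eq_norm_sq, ← neg_sub (proj C x) (proj C y), inner_neg_right,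
        sub_neg_eq_add, ← inner_add_left, ← inner_sub_left]
      congr 1
      abel
    linarith
  have h4 := real_inner_le_norm (x - y) (proj C x - proj C y)
  nlinarith [norm_nonneg (x - y), norm_nonneg (proj C x - proj C y)]

theorem continuous_proj (hne : C.Nonempty) (hcl : IsClosed C) (hcv : Convex ℝ C) :
    Continuous (proj C) :=
  (LipschitzWith.of_dist_le_mul (K := 1) fun x y => by
    simpa [dist_eq_norm] using norm_proj_sub_proj_le hne hcl hcv x y).continuous

theorem norm_sub_proj_le_add (hne : C.Nonempty) (hcl : IsClosed C)
    (x y : EuclideanSpace ℝ (Fin n)) : ‖x - proj C x‖ ≤ ‖y - proj C y‖ + ‖x - y‖ := by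
  have h := (proj_spec hne hcl x).2 _ (proj_spec hne hcl y).1
  have h2 := norm_add_le (x - y) (y - proj C y)
  rw [sub_add_sub_cancel] at h2
  linarith

/-- A relaxed projection step with relaxation parameter `β` decreases the squared distance to every
point of the set by at least `β (2 - β)` times the squared distance to the set. -/
theorem norm_relaxed_proj_sub_sq_le (hne : C.Nonempty) (hcl : IsClosed C) (hcv : Convex ℝ C)
    {β : ℝ} (hβ : 0 ≤ β) (z : EuclideanSpace ℝ (Fin n)) {y : EuclideanSpace ℝ (Fin n)}
    (hy : y ∈ C) :
    ‖z - β • (z - proj C z) - y‖ ^ 2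
      ≤ ‖z - y‖ ^ 2 - β * (2 - β) * ‖z - proj C z‖ ^ 2 := by
  have h1 := proj_inner_le_zero hne hcl hcv z hy
  have h2 : z - β • (z - proj C z) - y = (z - y) - β • (z - proj C z) := by abel
  have h3 : ⟪z - y, z - proj C z⟫
      = ‖z - proj C z‖ ^ 2 - ⟪z - proj C z, y - proj C z⟫ := by
    rw [← real_inner_self_eq_norm_sq, ← inner_sub_right, real_inner_comm]
    congr 1
    abel
  rw [h2, norm_sub_sq_real, inner_smul_right, h3, norm_smul, mul_pow, Real.norm_eq_abs, sq_abs]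
  nlinarith [mul_nonneg hβ (neg_nonneg.2 h1)]

end Projection

/-! ### Deterministic variational inequalities -/

section VariationalInequality

variable {n : ℕ} {K : Set (EuclideanSpace ℝ (Fin n))}
  {G : EuclideanSpace ℝ (Fin n) → EuclideanSpace ℝ (Fin n)} {L μ : ℝ}

theorem exists_variationalInequality_solution (hne : K.Nonempty) (hcl : IsClosed K)
    (hcv : Convex ℝ K) (hG : ∀ x y, ‖G x - G y‖ ≤ L * ‖x - y‖) (hμ : 0 < μ)
    (hmono : ∀ x ∈ K, ∀ y ∈ K, μ * ‖x - y‖ ^ 2 ≤ ⟪G x - G y, x - y⟫) :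
    ∃ xs ∈ K, ∀ y ∈ K, 0 ≤ ⟪G xs, y - xs⟫ := by
  have hD : 0 < L ^ 2 + μ ^ 2 := by positivity
  -- With this step size `x ↦ P_K (x - t G x)` contracts squared distances by `L² / (L² + μ²)`.
  set t : ℝ := μ / (L ^ 2 + μ ^ 2) with ht
  have ht0 : 0 < t := div_pos hμ hD
  set q : ℝ := L ^ 2 / (L ^ 2 + μ ^ 2) with hq
  have hq0 : 0 ≤ q := by positivity
  have hq1 : q < 1 := by rw [hq, div_lt_one hD]; nlinarith
  have htq : 1 - 2 * t * μ + t ^ 2 * L ^ 2 ≤ q := by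
    have h1 : t * (L ^ 2 + μ ^ 2) = μ := by rw [ht]; field_simp
    have h2 : q = 1 - t * μ := by rw [hq, ht]; field_simp; ring
    rw [h2]
    nlinarith [mul_nonneg ht0.le (mul_nonneg ht0.le (sq_nonneg μ))]
  set T : EuclideanSpace ℝ (Fin n) → EuclideanSpace ℝ (Fin n) :=
    fun x => proj K (x - t • G x) with hT
  have hmaps : Set.MapsTo T K K := fun x _ => (proj_spec hne hcl _).1
  have hcontr : ContractingWith (Real.toNNReal (Real.sqrt q)) (hmaps.restrict T K K) := by
    refine ⟨?_, LipschitzWith.of_dist_le_mul ?_⟩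
    · rw [Real.toNNReal_lt_one, Real.sqrt_lt' one_pos]
      simpa using hq1
    rintro ⟨x, hx⟩ ⟨y, hy⟩
    rw [Real.coe_toNNReal _ (Real.sqrt_nonneg _)]
    change dist (T x) (T y) ≤ Real.sqrt q * dist x y
    rw [dist_eq_norm, dist_eq_norm]
    refine (norm_proj_sub_proj_le hne hcl hcv _ _).trans ?_
    have h1 : ‖x - t • G x - (y - t • G y)‖ ^ 2 ≤ q * ‖x - y‖ ^ 2 := by
      have h2 : x - t • G x - (y - t • G y) = (x - y) - t • (G x - G y) := by
        rw [smul_sub]; abel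
      rw [h2, norm_sub_sq_real, inner_smul_right, real_inner_comm, norm_smul, mul_pow,
        Real.norm_eq_abs, sq_abs]
      have h3 := hmono x hx y hy
      have h4 : ‖G x - G y‖ ^ 2 ≤ L ^ 2 * ‖x - y‖ ^ 2 := by
        rw [← mul_pow]
        exact pow_le_pow_left₀ (norm_nonneg _) (hG x y) 2
      have h5 := mul_le_mul_of_nonneg_left h3 ht0.le
      have h6 := mul_le_mul_of_nonneg_left h4 (sq_nonneg t)
      have h7 := mul_le_mul_of_nonneg_right htq (sq_nonneg ‖x - y‖)
      nlinarith
    rw [← Real.sqrt_sq (norm_nonneg (x - y)), ← Real.sqrt_mul hq0]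
    exact Real.le_sqrt_of_sq_le h1
  obtain ⟨x₁, hx₁⟩ := hne
  obtain ⟨xs, hxs, hfix, -⟩ :=
    ContractingWith.exists_fixedPoint' hcl.isComplete hmaps hcontr hx₁ (edist_ne_top _ _)
  refine ⟨xs, hxs, fun y hy => ?_⟩
  have h1 := proj_inner_le_zero ⟨x₁, hx₁⟩ hcl hcv (xs - t • G xs) hy
  have h2 : proj K (xs - t • G xs) = xs := hfix
  rw [h2, sub_sub_cancel_left, inner_neg_left, real_inner_smul_left] at h1
  exact nonneg_of_mul_nonneg_right (by linarith) ht0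

theorem variationalInequality_solution_unique (hμ : 0 < μ)
    (hmono : ∀ x ∈ K, ∀ y ∈ K, μ * ‖x - y‖ ^ 2 ≤ ⟪G x - G y, x - y⟫)
    {x y : EuclideanSpace ℝ (Fin n)} (hx : x ∈ K) (hxs : ∀ z ∈ K, 0 ≤ ⟪G x, z - x⟫)
    (hy : y ∈ K) (hys : ∀ z ∈ K, 0 ≤ ⟪G y, z - y⟫) : x = y := by
  have h1 := hmono x hx y hy
  have h2 := hxs y hy
  have h3 := hys x hx
  rw [← neg_sub x y, inner_neg_right] at h2
  rw [inner_sub_left] at h1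
  have h4 : ‖x - y‖ ^ 2 ≤ 0 := nonpos_of_mul_nonpos_right (by linarith) hμ
  have h5 : ‖x - y‖ = 0 := by
    nlinarith [norm_nonneg (x - y)]
  exact sub_eq_zero.1 (norm_eq_zero.1 h5)

/-- Away from `K` the inner product `⟪G x, x - xs⟫` is still bounded below: strong monotonicity is
used at the projection of `x`, and the Lipschitz bound controls the error by the distance to `K`. -/
theorem inner_sub_solution_ge (hne : K.Nonempty) (hcl : IsClosed K)
    (hG : ∀ x y, ‖G x - G y‖ ≤ L * ‖x - y‖)
    (hcv : Convex ℝ K)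
    (hmono : ∀ x ∈ K, ∀ y ∈ K, μ * ‖x - y‖ ^ 2 ≤ ⟪G x - G y, x - y⟫)
    {xs : EuclideanSpace ℝ (Fin n)} (hxs : xs ∈ K) (hsol : ∀ y ∈ K, 0 ≤ ⟪G xs, y - xs⟫)
    {B : ℝ} (hB : ‖G xs‖ ≤ B) (hL : 0 ≤ L) (x : EuclideanSpace ℝ (Fin n)) :
    μ * ‖proj K x - xs‖ ^ 2 - (2 * L * ‖x - xs‖ + B) * ‖x - proj K x‖ ≤ ⟪G x, x - xs⟫ := by
  set p := proj K x with hp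
  have hpK : p ∈ K := (proj_spec hne hcl x).1
  have hpx : ‖p - xs‖ ≤ ‖x - xs‖ := by
    have h := norm_proj_sub_proj_le hne hcl hcv x xs
    rwa [← proj_unique hne hcl hcv xs xs hxs fun z _ => by simp] at h
  have hsplit : ⟪G x, x - xs⟫ = ⟪G p - G xs, p - xs⟫ + ⟪G xs, p - xs⟫ + ⟪G x - G p, x - xs⟫
      + (⟪G p - G xs, x - p⟫ + ⟪G xs, x - p⟫) := by
    have h : x - xs = (x - p) + (p - xs) := by abel
    rw [h]
    simp only [inner_sub_left, inner_add_right]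
    ring
  have h1 := hmono p hpK xs hxs
  have h2 := hsol p hpK
  have h3 : -(L * ‖x - p‖ * ‖x - xs‖) ≤ ⟪G x - G p, x - xs⟫ := by
    have := (abs_le.1 (abs_real_inner_le_norm (G x - G p) (x - xs))).1
    have := mul_le_mul_of_nonneg_right (hG x p) (norm_nonneg (x - xs))
    linarith
  have h4 : -(L * ‖x - xs‖ * ‖x - p‖) ≤ ⟪G p - G xs, x - p⟫ := by
    have := (abs_le.1 (abs_real_inner_le_norm (G p - G xs) (x - p))).1
    have := mul_le_mul_of_nonneg_right
      ((hG p xs).trans (mul_le_mul_of_nonneg_left hpx hL)) (norm_nonneg (x - p))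
    linarith
  have h5 : -(B * ‖x - p‖) ≤ ⟪G xs, x - p⟫ := by
    have := (abs_le.1 (abs_real_inner_le_norm (G xs) (x - p))).1
    have := mul_le_mul_of_nonneg_right hB (norm_nonneg (x - p))
    linarith
  rw [hsplit]
  linarith

end VariationalInequality

/-! ### Almost supermartingales with a contraction term -/

section AlmostSupermartingale

theorem prod_one_add_pos {a : ℕ → ℝ} (ha : ∀ k, 0 ≤ a k) (N : ℕ) :
    0 < ∏ k ∈ Finset.range N, (1 + a k) :=
  Finset.prod_pos fun k _ => by linarith [ha k]

theorem one_le_prod_one_add {a : ℕ → ℝ} (ha : ∀ k, 0 ≤ a k) (N : ℕ) :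
    1 ≤ ∏ k ∈ Finset.range N, (1 + a k) :=
  Finset.one_le_prod fun k _ => by linarith [ha k]

theorem prod_one_add_le_exp_tsum {a : ℕ → ℝ} (ha : ∀ k, 0 ≤ a k) (hsa : Summable a) (N : ℕ) :
    ∏ k ∈ Finset.range N, (1 + a k) ≤ Real.exp (∑' k, a k) :=
  (Real.prod_one_add_le_exp_sum _ ha).trans
    (Real.exp_le_exp.2 (hsa.sum_le_tsum _ fun k _ => ha k))

theorem exists_tendsto_prod_one_add {a : ℕ → ℝ} (ha : ∀ k, 0 ≤ a k) (hsa : Summable a) :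
    ∃ p, Tendsto (fun N => ∏ k ∈ Finset.range N, (1 + a k)) atTop (𝓝 p) := by
  refine ⟨_, tendsto_atTop_ciSup (monotone_nat_of_le_succ fun N => ?_)
    ⟨Real.exp (∑' k, a k), ?_⟩⟩
  · rw [Finset.prod_range_succ]
    exact le_mul_of_one_le_right (prod_one_add_pos ha N).le (by linarith [ha N])
  · rintro _ ⟨N, rfl⟩
    exact prod_one_add_le_exp_tsum ha hsa N

/-- Dividing by the partial products of `1 + a k` removes the growth factor from the recursion. -/
theorem div_prod_succ_le {a b θ u : ℕ → ℝ} (ha : ∀ k, 0 ≤ a k) (hb : ∀ k, 0 ≤ b k)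
    (hu : ∀ k, u (k + 1) ≤ (1 + a k - θ k) * u k + b k) (k : ℕ) :
    u (k + 1) / ∏ j ∈ Finset.range (k + 1), (1 + a j)
      ≤ u k / (∏ j ∈ Finset.range k, (1 + a j))
        - θ k * u k / (∏ j ∈ Finset.range (k + 1), (1 + a j)) + b k := by
  have hp := prod_one_add_pos ha k
  have hp' := prod_one_add_pos ha (k + 1)
  have h1 : u k / (∏ j ∈ Finset.range k, (1 + a j))
      = (1 + a k) * u k / ∏ j ∈ Finset.range (k + 1), (1 + a j) := by
    have : 0 < 1 + a k := by linarith [ha k]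
    rw [Finset.prod_range_succ]
    field_simp
  have h2 : b k / (∏ j ∈ Finset.range (k + 1), (1 + a j)) ≤ b k :=
    div_le_self (hb k) (one_le_prod_one_add ha _)
  calc _ ≤ ((1 + a k - θ k) * u k + b k) / ∏ j ∈ Finset.range (k + 1), (1 + a j) :=
        div_le_div_of_nonneg_right (hu k) hp'.le
    _ = (1 + a k) * u k / (∏ j ∈ Finset.range (k + 1), (1 + a j))
        - θ k * u k / (∏ j ∈ Finset.range (k + 1), (1 + a j))
        + b k / (∏ j ∈ Finset.range (k + 1), (1 + a j)) := by ring
    _ ≤ _ := by rw [h1]; linarith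

/-- The values cannot stay above `ε`: the rescaled recursion would then lose at least a fixed
multiple of `θ k` at each step, and `∑ θ k = ∞`. -/
theorem frequently_lt_of_recursion {a b θ u : ℕ → ℝ} (ha : ∀ k, 0 ≤ a k) (hb : ∀ k, 0 ≤ b k)
    (hθ : ∀ k, 0 ≤ θ k) (hsa : Summable a) (hsb : Summable b)
    (hsθ : Tendsto (fun N => ∑ k ∈ Finset.range N, θ k) atTop atTop) (hu0 : ∀ k, 0 ≤ u k)
    (hu : ∀ k, u (k + 1) ≤ (1 + a k - θ k) * u k + b k) {ε : ℝ} (hε : 0 < ε) :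
    ∃ᶠ k in atTop, u k < ε := by
  intro hcon
  obtain ⟨N, hN⟩ := eventually_atTop.1 hcon
  set C := Real.exp (∑' k, a k) with hC
  have hC0 : 0 < C := Real.exp_pos _
  have key : ∀ j, u (N + j) / (∏ i ∈ Finset.range (N + j), (1 + a i))
      + ε / C * ∑ i ∈ Finset.range (N + j), θ i
      ≤ u N / (∏ i ∈ Finset.range N, (1 + a i)) + ε / C * ∑ i ∈ Finset.range N, θ i
        + (∑ i ∈ Finset.range (N + j), b i) := by
    intro j
    induction j with
    | zero =>
      have : 0 ≤ ∑ i ∈ Finset.range N, b i := Finset.sum_nonneg fun i _ => hb i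
      simpa using this
    | succ j ih =>
      have h1 := div_prod_succ_le ha hb hu (N + j)
      have h2 : ε / C * θ (N + j)
          ≤ θ (N + j) * u (N + j) / ∏ i ∈ Finset.range (N + j + 1), (1 + a i) := by
        have h3 : ε ≤ u (N + j) := not_lt.1 (hN _ (Nat.le_add_right _ _))
        rw [div_mul_eq_mul_div, mul_comm ε]
        exact div_le_div₀ (mul_nonneg (hθ _) (hu0 _)) (mul_le_mul_of_nonneg_left h3 (hθ _))
          (prod_one_add_pos ha _) (prod_one_add_le_exp_tsum ha hsa _)
      rw [← add_assoc, Finset.sum_range_succ, Finset.sum_range_succ]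
      linarith
  set D := u N / (∏ i ∈ Finset.range N, (1 + a i)) + ε / C * ∑ i ∈ Finset.range N, θ i
        + ∑' i, b i with hD
  have hlim : Tendsto (fun j => ε / C * ∑ i ∈ Finset.range (j + N), θ i) atTop atTop :=
    ((tendsto_add_atTop_iff_nat N).2 hsθ).const_mul_atTop (div_pos hε hC0)
  obtain ⟨j, hj⟩ := (hlim.eventually_gt_atTop D).exists
  have h1 := key j
  have h2 : 0 ≤ u (N + j) / (∏ i ∈ Finset.range (N + j), (1 + a i)) :=
    div_nonneg (hu0 _) (prod_one_add_pos ha _).le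
  have h3 := hsb.sum_le_tsum (Finset.range (N + j)) fun i _ => hb i
  rw [add_comm j N] at hj
  linarith

/-- A form of the Robbins–Siegmund theorem with deterministic coefficients. If in conditional mean
`V (k + 1) ≤ (1 + a k - θ k) V k + b k`, where `a` and `b` are summable and `∑ θ k = ∞`, then
`V k → 0` almost surely: after rescaling, `V` is a supermartingale up to a summable drift, so it
converges, and its expectations come arbitrarily close to `0`, so the limit vanishes by Fatou. -/
theorem ae_tendsto_zero_of_setIntegral_le {Ω : Type*} {mΩ : MeasurableSpace Ω} {P : Measure Ω}
    [IsProbabilityMeasure P] (ℱ : Filtration ℕ mΩ) {V : ℕ → Ω → ℝ} (hadp : StronglyAdapted ℱ V)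
    (hint : ∀ k, Integrable (V k) P) (hV : ∀ k ω, 0 ≤ V k ω) {a b θ : ℕ → ℝ}
    (ha : ∀ k, 0 ≤ a k) (hb : ∀ k, 0 ≤ b k) (hθ : ∀ k, 0 ≤ θ k) (hsa : Summable a)
    (hsb : Summable b) (hsθ : Tendsto (fun N => ∑ k ∈ Finset.range N, θ k) atTop atTop)
    (hstep : ∀ k s, MeasurableSet[ℱ k] s →
      ∫ ω in s, V (k + 1) ω ∂P ≤ (1 + a k - θ k) * ∫ ω in s, V k ω ∂P + b k * P.real s) :
    ∀ᵐ ω ∂P, Tendsto (fun k => V k ω) atTop (𝓝 0) := by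
  set p : ℕ → ℝ := fun N => ∏ k ∈ Finset.range N, (1 + a k) with hp
  have hp0 : ∀ N, 0 < p N := prod_one_add_pos ha
  set u : ℕ → ℝ := fun k => ∫ ω, V k ω ∂P with hu
  have hu0 : ∀ k, 0 ≤ u k := fun k => integral_nonneg (hV k)
  have hurec : ∀ k, u (k + 1) ≤ (1 + a k - θ k) * u k + b k := fun k => by
    simpa using hstep k Set.univ MeasurableSet.univ
  -- The supermartingale, with its sign changed.
  set S : ℕ → Ω → ℝ := fun k ω => (∑ j ∈ Finset.range k, b j) - V k ω / p k with hS
  have hSint : ∀ k, Integrable (S k) P := fun k => (integrable_const _).sub ((hint k).div_const _)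
  have hsub : Submartingale S ℱ P := by
    refine submartingale_of_setIntegral_le_succ (fun k => ?_) hSint fun k s hs => ?_
    · exact (@stronglyMeasurable_const _ _ (ℱ k) _ _).sub ((hadp k).measurable.div_const (p k)).stronglyMeasurable
    · have h1 : ∀ k, ∫ ω in s, S k ω ∂P
          = P.real s * (∑ j ∈ Finset.range k, b j) - (∫ ω in s, V k ω ∂P) / p k := by
        intro k
        rw [hS, integral_sub (integrable_const _) ((hint k).div_const _).integrableOn,
          integral_div]
        simp
      have hVs : ∀ k, 0 ≤ ∫ ω in s, V k ω ∂P := fun k => integral_nonneg (hV k)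
      have hkp : p (k + 1) = p k * (1 + a k) := Finset.prod_range_succ _ _
      have h2 : (∫ ω in s, V (k + 1) ω ∂P) / p (k + 1)
          ≤ (∫ ω in s, V k ω ∂P) / p k + b k * P.real s := by
        have h3 : ∫ ω in s, V (k + 1) ω ∂P
            ≤ (1 + a k) * ∫ ω in s, V k ω ∂P + b k * P.real s := by
          nlinarith [hstep k s hs, mul_nonneg (hθ k) (hVs k)]
        have h4 : b k * P.real s / p (k + 1) ≤ b k * P.real s :=
          div_le_self (mul_nonneg (hb k) measureReal_nonneg) (one_le_prod_one_add ha _)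
        have h5 : (1 + a k) * (∫ ω in s, V k ω ∂P) / p (k + 1) = (∫ ω in s, V k ω ∂P) / p k := by
          have := hp0 k
          have : 0 < 1 + a k := by linarith [ha k]
          rw [hkp]
          field_simp
        have h6 := div_le_div_of_nonneg_right h3 (hp0 (k + 1)).le
        rw [add_div, h5] at h6
        linarith
      rw [h1, h1, Finset.sum_range_succ]
      linarith
  have hubd : ∀ k, u k / p k ≤ u 0 + ∑' j, b j := by
    have h : ∀ k, u k / p k ≤ u 0 + ∑ j ∈ Finset.range k, b j := by
      intro k
      induction k with
      | zero => simp [hp]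
      | succ k ih =>
        have h1 := div_prod_succ_le ha hb hurec k
        have h2 : 0 ≤ θ k * u k / p (k + 1) := div_nonneg (mul_nonneg (hθ k) (hu0 k)) (hp0 _).le
        rw [Finset.sum_range_succ]
        change u (k + 1) / p (k + 1) ≤ u k / p k - θ k * u k / p (k + 1) + b k at h1
        linarith
    intro k
    have := hsb.sum_le_tsum (Finset.range k) fun i _ => hb i
    linarith [h k]
  have hbdd : ∀ k, eLpNorm (S k) 1 P ≤ (Real.toNNReal (u 0 + 2 * ∑' j, b j) : ENNReal) := by
    intro k
    rw [eLpNorm_one_eq_lintegral_enorm, ← ofReal_integral_norm_eq_lintegral_enorm (hSint k)]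
    refine ENNReal.ofReal_le_ofReal ?_
    have hbk0 : 0 ≤ ∑ j ∈ Finset.range k, b j := Finset.sum_nonneg fun i _ => hb i
    have hbk := hsb.sum_le_tsum (Finset.range k) fun i _ => hb i
    calc ∫ ω, ‖S k ω‖ ∂P ≤ ∫ ω, ((∑ j ∈ Finset.range k, b j) + V k ω / p k) ∂P := by
          refine integral_mono (hSint k).norm ((integrable_const _).add ((hint k).div_const _))
            fun ω => ?_
          have h0 : 0 ≤ V k ω / p k := div_nonneg (hV k ω) (hp0 k).le
          rw [Real.norm_eq_abs, abs_le]
          constructor <;> simp only [hS] <;> linarith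
      _ = (∑ j ∈ Finset.range k, b j) + u k / p k := by
          rw [integral_add (integrable_const _) ((hint k).div_const _), integral_div]
          simp [hu]
      _ ≤ _ := by linarith [hubd k]
  obtain ⟨pl, hpl⟩ := exists_tendsto_prod_one_add ha hsa
  -- The measurable function `W` is the almost sure limit of `V`.
  set W : Ω → ENNReal := fun ω => liminf (fun k => ENNReal.ofReal (V k ω)) atTop with hW
  have hVm : ∀ k, Measurable (fun ω => ENNReal.ofReal (V k ω)) := fun k =>
    ((hadp k).measurable.mono (ℱ.le k) le_rfl).ennreal_ofReal
  have hWm : Measurable W := Measurable.liminf hVm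
  have hW0 : ∫⁻ ω, W ω ∂P = 0 := by
    refine le_antisymm (ENNReal.le_of_forall_pos_le_add fun ε hε _ => ?_) zero_le
    rw [zero_add]
    refine (lintegral_liminf_le hVm).trans ?_
    refine liminf_le_of_frequently_le' ?_
    refine (frequently_lt_of_recursion ha hb hθ hsa hsb hsθ hu0 hurec
      (NNReal.coe_pos.2 hε)).mono fun k hk => ?_
    rw [← ofReal_integral_eq_lintegral_ofReal (hint k) (ae_of_all _ (hV k))]
    exact (ENNReal.ofReal_le_ofReal hk.le).trans (by simp)
  have hWae : ∀ᵐ ω ∂P, W ω = 0 := (lintegral_eq_zero_iff hWm).1 hW0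
  filter_upwards [hsub.exists_ae_tendsto_of_bdd hbdd, hWae] with ω ⟨c, hc⟩ hω
  have hlim : Tendsto (fun k => V k ω) atTop (𝓝 ((∑' j, b j - c) * pl)) := by
    refine ((hsb.hasSum.tendsto_sum_nat.sub hc).mul hpl).congr fun k => ?_
    have := (hp0 k).ne'
    simp only [hS]
    change ((∑ j ∈ Finset.range k, b j) - ((∑ j ∈ Finset.range k, b j) - V k ω / p k)) * p k = _
    field_simp
    ring
  have h1 : W ω = ENNReal.ofReal ((∑' j, b j - c) * pl) :=
    (ENNReal.tendsto_ofReal hlim).liminf_eq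
  rw [h1, ENNReal.ofReal_eq_zero] at hω
  have h2 := ge_of_tendsto' hlim fun k => hV k ω
  rwa [le_antisymm hω h2] at hlim

end AlmostSupermartingale

/-! ### Substituting a past-measurable point into a random field -/

section Substitution

theorem integrable_inner_of_memLp_two {Ω F : Type*} {mΩ : MeasurableSpace Ω} {ν : Measure Ω}
    [NormedAddCommGroup F] [InnerProductSpace ℝ F] {f g : Ω → F} (hf : MemLp f 2 ν) (hg : MemLp g 2 ν) :
    Integrable (fun ω => ⟪f ω, g ω⟫) ν :=
  (hf.norm.integrable_mul hg.norm).mono (hf.1.inner hg.1) (ae_of_all _ fun ω => by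
    simpa using abs_real_inner_le_norm (f ω) (g ω))

variable {Ω F : Type*} {m mΩ : MeasurableSpace Ω} {ν : Measure Ω}
  [NormedAddCommGroup F] [MeasurableSpace F] [BorelSpace F]
  [SecondCountableTopology F]

theorem eLpNorm_two_pow_two {Ω F : Type*} {mΩ : MeasurableSpace Ω} {ν : Measure Ω}
    [NormedAddCommGroup F] (f : Ω → F) : eLpNorm f 2 ν ^ 2 = ∫⁻ ω, ‖f ω‖ₑ ^ 2 ∂ν := by
  have h := eLpNorm_nnreal_pow_eq_lintegral (f := f) (μ := ν) (p := 2) two_ne_zero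
  simpa only [NNReal.coe_ofNat, ENNReal.coe_ofNat, ENNReal.rpow_two] using h

theorem iUnion_fiber_eq_univ {γ : Type*} {Z : Ω → γ} (hZ : (Set.range Z).Finite) :
    ⋃ z ∈ hZ.toFinset, Z ⁻¹' {z} = Set.univ := by
  ext ω
  simp

theorem measurable_randomField_comp {Φ : F → Ω → F} (hcont : ∀ ω, Continuous fun x => Φ x ω)
    (hmeas : ∀ x, Measurable (Φ x)) {X : Ω → F} (hX : Measurable X) :
    Measurable fun ω => Φ (X ω) ω :=
  (measurable_uncurry_of_continuous_of_measurable hcont hmeas).comp (hX.prodMk measurable_id)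

/-- An `m`-measurable square-integrable function is a limit, both pointwise and in `L²`, of
`m`-measurable functions with finitely many values. -/
theorem exists_finiteRange_tendsto (hm : m ≤ mΩ) {X : Ω → F} (hX : Measurable[m] X)
    (hX2 : MemLp X 2 ν) :
    ∃ Y : ℕ → Ω → F, (∀ j, Measurable[m] (Y j)) ∧ (∀ j, (Set.range (Y j)).Finite) ∧
      (∀ ω, Tendsto (fun j => Y j ω) atTop (𝓝 (X ω))) ∧ (∀ j, MemLp (Y j) 2 ν) ∧
      Tendsto (fun j => eLpNorm (Y j - X) 2 ν) atTop (𝓝 0) := by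
  have hXs : StronglyMeasurable[m] X := hX.stronglyMeasurable
  have hX2' : MemLp X 2 (ν.trim hm) :=
    ⟨hXs.aestronglyMeasurable, by rw [eLpNorm_trim hm hXs]; exact hX2.2⟩
  let Y : ℕ → @SimpleFunc Ω m F := fun j =>
    @SimpleFunc.approxOn F Ω _ _ _ m X hX (Set.range X ∪ {0}) 0 (by simp) _ j
  have hYm : ∀ j, Measurable[m] (Y j) := fun j => @SimpleFunc.measurable _ _ m _ (Y j)
  have hYs : ∀ j, StronglyMeasurable[m] (Y j) := fun j =>
    (hYm j).stronglyMeasurable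
  refine ⟨fun j => Y j, hYm, fun j => @SimpleFunc.finite_range Ω F m (Y j), fun ω => ?_,
    fun j => ?_, ?_⟩
  · exact @SimpleFunc.tendsto_approxOn F Ω _ _ _ m X hX _ 0 (by simp) _ ω
      (subset_closure (by simp))
  · exact memLp_of_memLp_trim hm
      (@SimpleFunc.memLp_approxOn_range Ω F m _ _ 2 _ X (ν.trim hm) hX _ hX2' j)
  · have h := @SimpleFunc.tendsto_approxOn_range_Lp_eLpNorm Ω F m _ _ 2 _ X (by simp)
      (ν.trim hm) hX _ hX2'.2
    refine h.congr fun j => ?_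
    exact eLpNorm_trim hm ((hYs j).sub hXs)

theorem lintegral_randomField_sub_le_of_finiteRange (hm : m ≤ mΩ) {Φ : F → Ω → F} {c : ENNReal}
    (hΦ : ∀ x y C, MeasurableSet[m] C →
      ∫⁻ ω in C, ‖Φ x ω - Φ y ω‖ₑ ^ 2 ∂ν ≤ c * ‖x - y‖ₑ ^ 2 * ν C)
    {X Y : Ω → F} (hX : Measurable[m] X) (hY : Measurable[m] Y) (hXf : (Set.range X).Finite)
    (hYf : (Set.range Y).Finite) :
    ∫⁻ ω, ‖Φ (X ω) ω - Φ (Y ω) ω‖ₑ ^ 2 ∂ν ≤ c * ∫⁻ ω, ‖X ω - Y ω‖ₑ ^ 2 ∂ν := by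
  set Z : Ω → F × F := fun ω => (X ω, Y ω) with hZdef
  have hZ : Measurable[m] Z := hX.prodMk hY
  have hZf : (Set.range Z).Finite :=
    (hXf.prod hYf).subset (by rintro _ ⟨ω, rfl⟩; exact ⟨⟨ω, rfl⟩, ⟨ω, rfl⟩⟩)
  have hZm : ∀ z, MeasurableSet[m] (Z ⁻¹' {z}) := fun z => hZ (measurableSet_singleton z)
  have hdisj : Set.PairwiseDisjoint (hZf.toFinset : Set (F × F)) fun z => Z ⁻¹' {z} :=
    fun z _ z' _ h => (Set.disjoint_singleton.2 h).preimage Z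
  have hsum : ∀ f : Ω → ENNReal,
      ∫⁻ ω, f ω ∂ν = ∑ z ∈ hZf.toFinset, ∫⁻ ω in Z ⁻¹' {z}, f ω ∂ν := fun f => by
    rw [← lintegral_biUnion_finset hdisj (fun z _ => hm _ (hZm z)), iUnion_fiber_eq_univ,
      Measure.restrict_univ]
  rw [hsum, hsum, Finset.mul_sum]
  refine Finset.sum_le_sum fun z _ => ?_
  have h1 : ∫⁻ ω in Z ⁻¹' {z}, ‖Φ (X ω) ω - Φ (Y ω) ω‖ₑ ^ 2 ∂ν
      = ∫⁻ ω in Z ⁻¹' {z}, ‖Φ z.1 ω - Φ z.2 ω‖ₑ ^ 2 ∂ν :=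
    setLIntegral_congr_fun (hm _ (hZm z)) fun ω hω => by
      have hω' : Z ω = z := hω
      simp [← hω', hZdef]
  have h2 : ∫⁻ ω in Z ⁻¹' {z}, ‖X ω - Y ω‖ₑ ^ 2 ∂ν = ∫⁻ ω in Z ⁻¹' {z}, ‖z.1 - z.2‖ₑ ^ 2 ∂ν :=
    setLIntegral_congr_fun (hm _ (hZm z)) fun ω hω => by
      have hω' : Z ω = z := hω
      simp [← hω', hZdef]
  rw [h1, h2, setLIntegral_const, ← mul_assoc]
  exact hΦ _ _ _ (hZm z)

/-- A Lipschitz bound in conditional mean square at deterministic points extends to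
`m`-measurable random points. -/
theorem eLpNorm_randomField_sub_le (hm : m ≤ mΩ) {Φ : F → Ω → F}
    (hcont : ∀ ω, Continuous fun x => Φ x ω) (hmeas : ∀ x, Measurable (Φ x)) {L : ENNReal}
    (hL : L ≠ ⊤)
    (hΦ : ∀ x y C, MeasurableSet[m] C →
      ∫⁻ ω in C, ‖Φ x ω - Φ y ω‖ₑ ^ 2 ∂ν ≤ L ^ 2 * ‖x - y‖ₑ ^ 2 * ν C)
    {X Y : Ω → F} (hX : Measurable[m] X) (hY : Measurable[m] Y) (hX2 : MemLp X 2 ν)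
    (hY2 : MemLp Y 2 ν) :
    eLpNorm (fun ω => Φ (X ω) ω - Φ (Y ω) ω) 2 ν ≤ L * eLpNorm (X - Y) 2 ν := by
  obtain ⟨X', hX'm, hX'f, hX'X, hX'2, hX'L⟩ := exists_finiteRange_tendsto hm hX hX2
  obtain ⟨Y', hY'm, hY'f, hY'Y, hY'2, hY'L⟩ := exists_finiteRange_tendsto hm hY hY2
  have hstep : ∀ j, eLpNorm (fun ω => Φ (X' j ω) ω - Φ (Y' j ω) ω) 2 ν
      ≤ L * (eLpNorm (X' j - X) 2 ν + eLpNorm (X - Y) 2 ν + eLpNorm (Y' j - Y) 2 ν) := by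
    intro j
    have h1 : eLpNorm (fun ω => Φ (X' j ω) ω - Φ (Y' j ω) ω) 2 ν
        ≤ L * eLpNorm (X' j - Y' j) 2 ν := by
      rw [← ENNReal.pow_le_pow_left_iff two_ne_zero, mul_pow, eLpNorm_two_pow_two,
        eLpNorm_two_pow_two]
      exact lintegral_randomField_sub_le_of_finiteRange hm hΦ (hX'm j) (hY'm j) (hX'f j) (hY'f j)
    refine h1.trans (mul_le_mul_right ?_ L)
    have h2 : X' j - Y' j = (X' j - X + (X - Y)) - (Y' j - Y) := by abel
    rw [h2]
    refine (eLpNorm_sub_le (((hX'2 j).1.sub hX2.1).add (hX2.1.sub hY2.1))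
      ((hY'2 j).1.sub hY2.1) (by norm_num)).trans ?_
    gcongr
    exact eLpNorm_add_le ((hX'2 j).1.sub hX2.1) (hX2.1.sub hY2.1) (by norm_num)
  have hlim : Tendsto (fun j => L * (eLpNorm (X' j - X) 2 ν + eLpNorm (X - Y) 2 ν
      + eLpNorm (Y' j - Y) 2 ν)) atTop (𝓝 (L * (0 + eLpNorm (X - Y) 2 ν + 0))) :=
    ENNReal.Tendsto.const_mul ((hX'L.add tendsto_const_nhds).add hY'L) (Or.inr hL)
  rw [zero_add, add_zero] at hlim
  have hm' : ∀ {W : Ω → F}, Measurable[m] W → Measurable W := fun h => h.mono hm le_rfl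
  refine (Lp.eLpNorm_lim_le_liminf_eLpNorm (f := fun j ω => Φ (X' j ω) ω - Φ (Y' j ω) ω)
    (fun j => ?_) _ (ae_of_all _ fun ω => ?_)).trans ?_
  · exact ((measurable_randomField_comp hcont hmeas (hm' (hX'm j))).sub
      (measurable_randomField_comp hcont hmeas (hm' (hY'm j)))).aestronglyMeasurable
  · exact (((hcont ω).tendsto _).comp (hX'X ω)).sub (((hcont ω).tendsto _).comp (hY'Y ω))
  · rw [← hlim.liminf_eq]
    exact liminf_le_liminf (Eventually.of_forall hstep)

theorem memLp_randomField_comp [IsFiniteMeasure ν] (hm : m ≤ mΩ) {Φ : F → Ω → F}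
    (hcont : ∀ ω, Continuous fun x => Φ x ω) (hmeas : ∀ x, Measurable (Φ x)) {L : ENNReal}
    (hL : L ≠ ⊤)
    (hΦ : ∀ x y C, MeasurableSet[m] C →
      ∫⁻ ω in C, ‖Φ x ω - Φ y ω‖ₑ ^ 2 ∂ν ≤ L ^ 2 * ‖x - y‖ₑ ^ 2 * ν C)
    {y : F} (hy : MemLp (Φ y) 2 ν) {X : Ω → F} (hX : Measurable[m] X) (hX2 : MemLp X 2 ν) :
    MemLp (fun ω => Φ (X ω) ω) 2 ν := by
  have hmeasX := measurable_randomField_comp hcont hmeas (hX.mono hm le_rfl)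
  have h : MemLp (fun ω => Φ (X ω) ω - Φ y ω) 2 ν :=
    ⟨(hmeasX.sub (hmeas y)).aestronglyMeasurable,
      (eLpNorm_randomField_sub_le hm hcont hmeas hL hΦ hX measurable_const hX2
        (memLp_const y)).trans_lt (ENNReal.mul_lt_top hL.lt_top (hX2.sub (memLp_const y)).2)⟩
  refine (h.add hy).ae_eq (ae_of_all _ fun ω => ?_)
  simp

variable [InnerProductSpace ℝ F]

/-- If the field `D` has conditional mean zero at every deterministic point, then it is orthogonal
in `L²` to every `m`-measurable vector when evaluated there. -/
theorem integral_inner_randomField_comp_eq_zero [CompleteSpace F] [IsFiniteMeasure ν] (hm : m ≤ mΩ)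
    {D : F → Ω → F} (hcont : ∀ ω, Continuous fun x => D x ω) (hmeas : ∀ x, Measurable (D x))
    {L : ENNReal} (hL : L ≠ ⊤)
    (hD : ∀ x y C, MeasurableSet[m] C →
      ∫⁻ ω in C, ‖D x ω - D y ω‖ₑ ^ 2 ∂ν ≤ L ^ 2 * ‖x - y‖ₑ ^ 2 * ν C)
    (hD0 : ∀ x C, MeasurableSet[m] C → ∫ ω in C, D x ω ∂ν = 0)
    {y : F} (hy : MemLp (D y) 2 ν) {X : Ω → F} (hX : Measurable[m] X) (hX2 : MemLp X 2 ν) :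
    ∫ ω, ⟪D (X ω) ω, X ω - y⟫ ∂ν = 0 := by
  obtain ⟨X', hX'm, hX'f, -, hX'2, hX'L⟩ := exists_finiteRange_tendsto hm hX hX2
  have hmem : ∀ {W : Ω → F}, Measurable[m] W → MemLp W 2 ν → MemLp (fun ω => D (W ω) ω) 2 ν :=
    fun h h' => memLp_randomField_comp hm hcont hmeas hL hD hy h h'
  have hsimple : ∀ j, ∫ ω, ⟪D (X' j ω) ω, X' j ω - y⟫ ∂ν = 0 := by
    intro j
    have hfm : ∀ z, MeasurableSet[m] (X' j ⁻¹' {z}) := fun z =>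
      hX'm j (measurableSet_singleton z)
    have hdisj : Set.PairwiseDisjoint ((hX'f j).toFinset : Set F) fun z => X' j ⁻¹' {z} :=
      fun z _ z' _ h => (Set.disjoint_singleton.2 h).preimage _
    have hint : Integrable (fun ω => ⟪D (X' j ω) ω, X' j ω - y⟫) ν :=
      integrable_inner_of_memLp_two (hmem (hX'm j) (hX'2 j)) ((hX'2 j).sub (memLp_const y))
    rw [← setIntegral_univ, ← iUnion_fiber_eq_univ (hX'f j),
      integral_biUnion_finset _ (fun z _ => hm _ (hfm z)) hdisj fun z _ => hint.integrableOn]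
    refine Finset.sum_eq_zero fun z _ => ?_
    have h1 : ∫ ω in X' j ⁻¹' {z}, ⟪D (X' j ω) ω, X' j ω - y⟫ ∂ν
        = ∫ ω in X' j ⁻¹' {z}, ⟪z - y, D z ω⟫ ∂ν :=
      setIntegral_congr_fun (hm _ (hfm z)) fun ω hω => by
        have hω' : X' j ω = z := hω
        simp only [hω']
        exact real_inner_comm _ _
    have h2 : MemLp (D z) 2 ν := hmem measurable_const (memLp_const z)
    rw [h1, integral_inner (h2.integrable (by norm_num)).integrableOn, hD0 z _ (hfm z),
      inner_zero_right]
  have hDX := hmem hX hX2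
  have hXy := hX2.sub (memLp_const y)
  have hDX' := fun j => hmem (hX'm j) (hX'2 j)
  have hXy' := fun j => (hX'2 j).sub (memLp_const y)
  have hlim1 : Tendsto (fun j => (hDX' j).toLp _) atTop (𝓝 (hDX.toLp _)) := by
    rw [Lp.tendsto_Lp_iff_tendsto_eLpNorm'']
    have h0 : Tendsto (fun j => L * eLpNorm (X' j - X) 2 ν) atTop (𝓝 (L * 0)) :=
      ENNReal.Tendsto.const_mul hX'L (Or.inr hL)
    rw [mul_zero] at h0
    exact tendsto_of_tendsto_of_tendsto_of_le_of_le tendsto_const_nhds h0 (fun _ => zero_le)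
      fun j => eLpNorm_randomField_sub_le hm hcont hmeas hL hD (hX'm j) hX (hX'2 j) hX2
  have hlim2 : Tendsto (fun j => (hXy' j).toLp _) atTop (𝓝 (hXy.toLp _)) := by
    rw [Lp.tendsto_Lp_iff_tendsto_eLpNorm'']
    simpa using hX'L
  have hinner : ∀ {f g : Ω → F} (hf : MemLp f 2 ν) (hg : MemLp g 2 ν),
      ⟪hf.toLp f, hg.toLp g⟫ = ∫ ω, ⟪f ω, g ω⟫ ∂ν := by
    intro f g hf hg
    rw [L2.inner_def]
    refine integral_congr_ae ?_
    filter_upwards [hf.coeFn_toLp, hg.coeFn_toLp] with ω h1 h2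
    rw [h1, h2]
  have hlim := hlim1.inner (𝕜 := ℝ) hlim2
  rw [hinner] at hlim
  refine tendsto_nhds_unique hlim (tendsto_const_nhds.congr fun j => ?_)
  rw [hinner]
  exact (hsimple j).symm

/-- A lower bound `c` for the conditional probability of the event `S` given `m`, tested against a
nonnegative `m`-measurable function. -/
theorem const_mul_integral_le_setIntegral (hm : m ≤ mΩ) {S : Set Ω} {c : ℝ}
    (hc : 0 ≤ c) (hcS : ∀ C, MeasurableSet[m] C → ENNReal.ofReal c * ν C ≤ ν (C ∩ S))
    {g : Ω → ℝ} (hg : Measurable[m] g) (hg0 : ∀ ω, 0 ≤ g ω) (hgi : Integrable g ν) :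
    c * ∫ ω, g ω ∂ν ≤ ∫ ω in S, g ω ∂ν := by
  have h1 : ((ENNReal.ofReal c) • ν).trim hm ≤ (ν.restrict S).trim hm := by
    refine (@Measure.le_iff _ m _ _).2 fun C hC => ?_
    rw [trim_measurableSet_eq hm hC, trim_measurableSet_eq hm hC,
      Measure.restrict_apply (hm C hC)]
    exact hcS C hC
  have hgm : Measurable[m] fun ω => ENNReal.ofReal (g ω) := hg.ennreal_ofReal
  have h2 : ENNReal.ofReal c * ∫⁻ ω, ENNReal.ofReal (g ω) ∂ν
      ≤ ∫⁻ ω in S, ENNReal.ofReal (g ω) ∂ν := by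
    rw [← smul_eq_mul, ← lintegral_smul_measure, ← lintegral_trim hm hgm,
      ← lintegral_trim hm hgm]
    exact lintegral_mono' h1 le_rfl
  rw [← ofReal_integral_eq_lintegral_ofReal hgi (ae_of_all _ hg0),
    ← ofReal_integral_eq_lintegral_ofReal hgi.integrableOn (ae_of_all _ hg0),
    ← ENNReal.ofReal_mul hc] at h2
  exact (ENNReal.ofReal_le_ofReal_iff (integral_nonneg hg0)).1 h2

end Substitution

/-! ### One step of the algorithm -/

section Step

theorem lintegral_enorm_sq_eq_ofReal {Ω F : Type*} {mΩ : MeasurableSpace Ω} {ν : Measure Ω}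
    [NormedAddCommGroup F] {f : Ω → F} (hf : Integrable (fun ω => ‖f ω‖ ^ 2) ν) :
    ∫⁻ ω, ‖f ω‖ₑ ^ 2 ∂ν = ENNReal.ofReal (∫ ω, ‖f ω‖ ^ 2 ∂ν) := by
  rw [ofReal_integral_eq_lintegral_ofReal hf (ae_of_all _ fun ω => by positivity)]
  refine lintegral_congr fun ω => ?_
  rw [ENNReal.ofReal_pow (norm_nonneg _), ofReal_norm]

theorem norm_sub_sq_le_two_mul {F : Type*} [NormedAddCommGroup F] (x y : F) :
    ‖x - y‖ ^ 2 ≤ 2 * ‖x‖ ^ 2 + 2 * ‖y‖ ^ 2 := by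
  have h := pow_le_pow_left₀ (norm_nonneg _) (norm_sub_le x y) 2
  nlinarith [sq_nonneg (‖x‖ - ‖y‖)]

theorem setLIntegral_enorm_sub_sq_le {Ω F : Type*} {m mΩ : MeasurableSpace Ω} {ν : Measure Ω}
    [NormedAddCommGroup F] [IsFiniteMeasure ν] {Φ : F → Ω → F} {L : ℝ} (hL : 0 ≤ L)
    (hΦi : ∀ x y, Integrable (fun ω => ‖Φ x ω - Φ y ω‖ ^ 2) ν)
    (hΦ : ∀ x y C, MeasurableSet[m] C →
      ∫ ω in C, ‖Φ x ω - Φ y ω‖ ^ 2 ∂ν ≤ L ^ 2 * ‖x - y‖ ^ 2 * ν.real C) (x y : F) (C : Set Ω)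
    (hC : MeasurableSet[m] C) :
    ∫⁻ ω in C, ‖Φ x ω - Φ y ω‖ₑ ^ 2 ∂ν ≤ ENNReal.ofReal L ^ 2 * ‖x - y‖ₑ ^ 2 * ν C := by
  rw [lintegral_enorm_sq_eq_ofReal (hΦi x y).integrableOn]
  refine (ENNReal.ofReal_le_ofReal (hΦ x y C hC)).trans ?_
  rw [ENNReal.ofReal_mul (by positivity), ENNReal.ofReal_mul (by positivity),
    ENNReal.ofReal_pow hL, ENNReal.ofReal_pow (norm_nonneg _), ofReal_norm, ofReal_measureReal]

section RandomField

variable {Ω F : Type*} {m mΩ : MeasurableSpace Ω} {ν : Measure Ω}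
  [NormedAddCommGroup F] [MeasurableSpace F] [BorelSpace F]
  [SecondCountableTopology F] {Φ : F → Ω → F} {G : F → F} {L B : ℝ} {xs : F} {X : Ω → F}

variable [IsFiniteMeasure ν] (hm : m ≤ mΩ) (hcont : ∀ ω, Continuous fun x => Φ x ω)
  (hmeas : ∀ x, Measurable (Φ x)) (hL : 0 ≤ L)
  (hΦi : ∀ x y, Integrable (fun ω => ‖Φ x ω - Φ y ω‖ ^ 2) ν)
  (hΦ : ∀ x y C, MeasurableSet[m] C →
    ∫ ω in C, ‖Φ x ω - Φ y ω‖ ^ 2 ∂ν ≤ L ^ 2 * ‖x - y‖ ^ 2 * ν.real C)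
  (hxi : Integrable (fun ω => ‖Φ xs ω‖ ^ 2) ν)
  (hX : Measurable[m] X) (hX2 : MemLp X 2 ν)

include hm hcont hmeas hL hΦi hΦ hxi hX hX2

theorem memLp_two_randomField_comp : MemLp (fun ω => Φ (X ω) ω) 2 ν :=
  memLp_randomField_comp hm hcont hmeas ENNReal.ofReal_ne_top
    (setLIntegral_enorm_sub_sq_le hL hΦi hΦ)
    ((memLp_two_iff_integrable_sq_norm (hmeas xs).aestronglyMeasurable).2 hxi) hX hX2

theorem integral_norm_sq_randomField_comp_le
    (hB : ∫ ω, ‖Φ xs ω‖ ^ 2 ∂ν ≤ B ^ 2 * ν.real Set.univ) :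
    ∫ ω, ‖Φ (X ω) ω‖ ^ 2 ∂ν
      ≤ 2 * L ^ 2 * ∫ ω, ‖X ω - xs‖ ^ 2 ∂ν + 2 * B ^ 2 * ν.real Set.univ := by
  have h0 := memLp_two_randomField_comp hm hcont hmeas hL hΦi hΦ hxi hX hX2
  have h1 : MemLp (Φ xs) 2 ν :=
    (memLp_two_iff_integrable_sq_norm (hmeas xs).aestronglyMeasurable).2 hxi
  have h2 := (h0.sub h1).integrable_norm_pow two_ne_zero
  have h3 := (hX2.sub (memLp_const xs)).integrable_norm_pow two_ne_zero
  simp only [Pi.sub_apply] at h2 h3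
  have h4 := eLpNorm_randomField_sub_le hm hcont hmeas ENNReal.ofReal_ne_top
    (setLIntegral_enorm_sub_sq_le hL hΦi hΦ) hX (measurable_const (a := xs)) hX2 (memLp_const xs)
  rw [← ENNReal.pow_le_pow_left_iff two_ne_zero, mul_pow, eLpNorm_two_pow_two,
    eLpNorm_two_pow_two, lintegral_enorm_sq_eq_ofReal h2] at h4
  simp only [Pi.sub_apply] at h4
  rw [lintegral_enorm_sq_eq_ofReal h3, ← ENNReal.ofReal_pow hL,
    ← ENNReal.ofReal_mul (by positivity), ENNReal.ofReal_le_ofReal_iff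
    (mul_nonneg (by positivity) (integral_nonneg fun ω => by positivity))] at h4
  have h5 : ∫ ω, ‖Φ (X ω) ω‖ ^ 2 ∂ν
      ≤ ∫ ω, (2 * ‖Φ (X ω) ω - Φ xs ω‖ ^ 2 + 2 * ‖Φ xs ω‖ ^ 2) ∂ν := by
    refine integral_mono (h0.integrable_norm_pow two_ne_zero)
      ((h2.const_mul 2).add (hxi.const_mul 2)) fun ω => ?_
    have := norm_sub_sq_le_two_mul (Φ (X ω) ω - Φ xs ω) (-Φ xs ω)
    simpa using this
  rw [integral_add (h2.const_mul 2) (hxi.const_mul 2), integral_const_mul,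
    integral_const_mul] at h5
  linarith

theorem integral_inner_randomField_comp [InnerProductSpace ℝ F] [CompleteSpace F]
    (hG : ∀ x y, ‖G x - G y‖ ≤ L * ‖x - y‖)
    (hΦG : ∀ x C, MeasurableSet[m] C → ∫ ω in C, Φ x ω ∂ν = ν.real C • G x) :
    MemLp (fun ω => G (X ω)) 2 ν ∧
      ∫ ω, ⟪Φ (X ω) ω, X ω - xs⟫ ∂ν = ∫ ω, ⟪G (X ω), X ω - xs⟫ ∂ν := by
  have hGc : Continuous G :=
    (LipschitzWith.of_dist_le_mul (K := Real.toNNReal L) fun x y => by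
      rw [dist_eq_norm, dist_eq_norm, Real.coe_toNNReal _ hL]
      exact hG x y).continuous
  have hΦm : ∀ {Y : Ω → F}, Measurable[m] Y → MemLp Y 2 ν → MemLp (fun ω => Φ (Y ω) ω) 2 ν :=
    fun h h' => memLp_two_randomField_comp hm hcont hmeas hL hΦi hΦ hxi h h'
  have hGX : MemLp (fun ω => G (X ω)) 2 ν := by
    have h1 : MemLp (fun ω => G (X ω) - G xs) 2 ν :=
      (hX2.sub (memLp_const xs)).of_le_mul (c := L)
        ((hGc.measurable.comp (hX.mono hm le_rfl)).sub_const _).aestronglyMeasurable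
        (ae_of_all _ fun ω => hG _ _)
    refine (h1.add (memLp_const (G xs))).ae_eq (ae_of_all _ fun ω => ?_)
    simp
  refine ⟨hGX, ?_⟩
  have hpt : ∀ x y ω, ‖(Φ x ω - G x) - (Φ y ω - G y)‖ ^ 2
      ≤ 2 * ‖Φ x ω - Φ y ω‖ ^ 2 + 2 * (L ^ 2 * ‖x - y‖ ^ 2) := by
    intro x y ω
    rw [sub_sub_sub_comm]
    refine (norm_sub_sq_le_two_mul _ _).trans ?_
    have := pow_le_pow_left₀ (norm_nonneg _) (hG x y) 2
    rw [mul_pow] at this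
    linarith
  have hDm : ∀ x, Measurable fun ω => Φ x ω - G x := fun x => (hmeas x).sub_const _
  have hDi : ∀ x y, Integrable (fun ω => ‖(Φ x ω - G x) - (Φ y ω - G y)‖ ^ 2) ν := fun x y =>
    (((hΦi x y).const_mul 2).add (integrable_const _)).mono'
      (((hDm x).sub (hDm y)).norm.pow_const 2).aestronglyMeasurable
      (ae_of_all _ fun ω => by
        rw [Real.norm_of_nonneg (by positivity)]
        exact hpt x y ω)
  have hD : ∀ x y C, MeasurableSet[m] C →
      ∫ ω in C, ‖(Φ x ω - G x) - (Φ y ω - G y)‖ ^ 2 ∂ν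
        ≤ (2 * L) ^ 2 * ‖x - y‖ ^ 2 * ν.real C := by
    intro x y C hC
    calc ∫ ω in C, ‖(Φ x ω - G x) - (Φ y ω - G y)‖ ^ 2 ∂ν
        ≤ ∫ ω in C, (2 * ‖Φ x ω - Φ y ω‖ ^ 2 + 2 * (L ^ 2 * ‖x - y‖ ^ 2)) ∂ν :=
          integral_mono (hDi x y).integrableOn
            (Integrable.add ((hΦi x y).const_mul 2).integrableOn (integrable_const _)) (hpt x y)
      _ = 2 * (∫ ω in C, ‖Φ x ω - Φ y ω‖ ^ 2 ∂ν) + ν.real C * (2 * (L ^ 2 * ‖x - y‖ ^ 2)) := by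
          rw [integral_add ((hΦi x y).const_mul 2).integrableOn (integrable_const _),
            integral_const_mul, integral_const]
          simp
      _ ≤ _ := by linarith [hΦ x y C hC]
  have hxs2 : MemLp (Φ xs) 2 ν :=
    (memLp_two_iff_integrable_sq_norm (hmeas xs).aestronglyMeasurable).2 hxi
  have h0 := integral_inner_randomField_comp_eq_zero hm (D := fun x ω => Φ x ω - G x)
    (fun ω => (hcont ω).sub hGc) hDm ENNReal.ofReal_ne_top
    (setLIntegral_enorm_sub_sq_le (by positivity) hDi hD)
    (fun x C hC => by
      rw [integral_sub ((hΦm measurable_const (memLp_const x)).integrable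
        (by norm_num)).integrableOn (integrable_const _), hΦG x C hC, integral_const]
      simp)
    (y := xs) (hxs2.sub (memLp_const _)) hX hX2
  have hXx : MemLp (fun ω => X ω - xs) 2 ν := hX2.sub (memLp_const xs)
  simp only [inner_sub_left] at h0
  rw [integral_sub (integrable_inner_of_memLp_two (hΦm hX hX2) hXx)
    (integrable_inner_of_memLp_two hGX hXx)] at h0
  linarith

end RandomField

end Step

section StepBound

variable {n N : ℕ}

theorem norm_twoStep_sub_sq_le {C : Set (EuclideanSpace ℝ (Fin n))} (hcl : IsClosed C)
    (hcv : Convex ℝ C) {α β : ℝ} (hβ : 0 ≤ β) (hβ2 : β ≤ 2)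
    {xs : EuclideanSpace ℝ (Fin n)} (hxs : xs ∈ C) (x f : EuclideanSpace ℝ (Fin n)) :
    ‖x - α • f - β • (x - α • f - proj C (x - α • f)) - xs‖ ^ 2
      ≤ ‖x - xs‖ ^ 2 - 2 * α * ⟪f, x - xs⟫ + 2 * α ^ 2 * ‖f‖ ^ 2
        - β * (2 - β) / 2 * ‖x - proj C x‖ ^ 2 := by
  have hne : C.Nonempty := ⟨xs, hxs⟩
  set z := x - α • f with hz
  have h1 := norm_relaxed_proj_sub_sq_le hne hcl hcv hβ z hxs
  have hf : ‖α • f‖ ^ 2 = α ^ 2 * ‖f‖ ^ 2 := by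
    rw [norm_smul, mul_pow, Real.norm_eq_abs, sq_abs]
  have h2 : ‖z - xs‖ ^ 2 = ‖x - xs‖ ^ 2 - 2 * α * ⟪f, x - xs⟫ + α ^ 2 * ‖f‖ ^ 2 := by
    have : z - xs = (x - xs) - α • f := by rw [hz]; abel
    rw [this, norm_sub_sq_real, inner_smul_right, real_inner_comm, hf]
    ring
  have h3 : ‖x - proj C x‖ ^ 2 ≤ 2 * ‖z - proj C z‖ ^ 2 + 2 * (α ^ 2 * ‖f‖ ^ 2) := by
    have h := norm_sub_proj_le_add hne hcl x z
    have hxz : x - z = α • f := by rw [hz]; abel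
    rw [hxz] at h
    have h' := pow_le_pow_left₀ (norm_nonneg _) h 2
    rw [← hf]
    nlinarith [sq_nonneg (‖z - proj C z‖ - ‖α • f‖)]
  have hγ0 : 0 ≤ β * (2 - β) := mul_nonneg hβ (by linarith)
  have hγ1 : β * (2 - β) ≤ 1 := by nlinarith [sq_nonneg (β - 1)]
  have h4 := mul_le_mul_of_nonneg_left h3 hγ0
  have h5 : β * (2 - β) * (α ^ 2 * ‖f‖ ^ 2) ≤ 1 * (α ^ 2 * ‖f‖ ^ 2) :=
    mul_le_mul_of_nonneg_right hγ1 (by positivity)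
  linarith

/-- The scalar inequality behind the contraction of the step: `e` is the distance to the solution,
`d` the distance to the feasible set, `q` the distance from the projection to the solution, and
`I` the inner product of the mean field with the error. -/
theorem descent_le {μ L B α γ c e d q I : ℝ} (hμ : 0 < μ) (hα : 0 < α)
    (hγ : 0 < γ) (hc : 0 < c) (hI : μ * q ^ 2 - (2 * L * e + B) * d ≤ I)
    (he : e ^ 2 ≤ 2 * q ^ 2 + 2 * d ^ 2) :
    e ^ 2 - 2 * α * I - γ * c / 2 * d ^ 2
      ≤ (1 + 32 * L ^ 2 / c * (α ^ 2 / γ) - min μ (c / 8) * min α γ) * e ^ 2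
        + 8 * B ^ 2 / c * (α ^ 2 / γ) := by
  have h1 : 2 * α * ((2 * L * e + B) * d)
      ≤ γ * c / 4 * d ^ 2 + 4 / c * (α ^ 2 / γ) * (2 * L * e + B) ^ 2 := by
    have h : γ * c / 4 * d ^ 2 + 4 / c * (α ^ 2 / γ) * (2 * L * e + B) ^ 2
        - 2 * α * ((2 * L * e + B) * d)
        = (γ * c * d - 4 * α * (2 * L * e + B)) ^ 2 / (4 * (γ * c)) := by
      field_simp
      ring
    have : 0 ≤ (γ * c * d - 4 * α * (2 * L * e + B)) ^ 2 / (4 * (γ * c)) := by positivity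
    linarith
  have h2 : 4 / c * (α ^ 2 / γ) * (2 * L * e + B) ^ 2
      ≤ 4 / c * (α ^ 2 / γ) * (8 * L ^ 2 * e ^ 2 + 2 * B ^ 2) :=
    mul_le_mul_of_nonneg_left (by nlinarith [sq_nonneg (2 * L * e - B)]) (by positivity)
  have h2' : 4 / c * (α ^ 2 / γ) * (8 * L ^ 2 * e ^ 2 + 2 * B ^ 2)
      = 32 * L ^ 2 / c * (α ^ 2 / γ) * e ^ 2 + 8 * B ^ 2 / c * (α ^ 2 / γ) := by ring
  have hκ0 : 0 ≤ min μ (c / 8) * min α γ := by positivity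
  have h3 : min μ (c / 8) * min α γ ≤ μ * α := by
    gcongr
    · exact min_le_left _ _
    · exact min_le_left _ _
  have h4 : min μ (c / 8) * min α γ ≤ c / 8 * γ := by
    gcongr
    · exact min_le_right _ _
    · exact min_le_right _ _
  have h5 := mul_le_mul_of_nonneg_left he hκ0
  have h6 := mul_le_mul_of_nonneg_right h3 (sq_nonneg q)
  have h7 := mul_le_mul_of_nonneg_right h4 (sq_nonneg d)
  have h8 := mul_le_mul_of_nonneg_left hI hα.le
  linarith

variable {Ω : Type*} {m mΩ : MeasurableSpace Ω} {ν : Measure Ω}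
  {K : Fin N → Set (EuclideanSpace ℝ (Fin n))} {w : Ω → Fin N}
  {X : Ω → EuclideanSpace ℝ (Fin n)} {xs : EuclideanSpace ℝ (Fin n)}

/-- Sampling a constraint with conditional probabilities at least `p`, under linear regularity,
controls the distance to the whole feasible set. -/
theorem integral_dist_feasible_le [IsFiniteMeasure ν] (hm : m ≤ mΩ) (hcl : ∀ i, IsClosed (K i))
    (hcv : ∀ i, Convex ℝ (K i)) (hxs : xs ∈ ⋂ i, K i) {η p : ℝ} (hη : 0 < η) (hp : 0 ≤ p)
    (hreg : ∀ x : EuclideanSpace ℝ (Fin n),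
      ‖x - proj (⋂ i, K i) x‖ ^ 2 ≤ η * ⨆ i, ‖x - proj (K i) x‖ ^ 2)
    (hw : Measurable w)
    (hp' : ∀ i C, MeasurableSet[m] C → ENNReal.ofReal p * ν C ≤ ν (C ∩ {ω | w ω = i}))
    (hX : Measurable[m] X) (hX2 : MemLp X 2 ν) :
    Integrable (fun ω => ‖X ω - proj (⋂ i, K i) (X ω)‖ ^ 2) ν ∧
    Integrable (fun ω => ‖X ω - proj (K (w ω)) (X ω)‖ ^ 2) ν ∧
    p / η * ∫ ω, ‖X ω - proj (⋂ i, K i) (X ω)‖ ^ 2 ∂ν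
      ≤ ∫ ω, ‖X ω - proj (K (w ω)) (X ω)‖ ^ 2 ∂ν := by
  have hxi : ∀ i, xs ∈ K i := Set.mem_iInter.1 hxs
  have hV : Integrable (fun ω => ‖X ω - xs‖ ^ 2) ν :=
    (hX2.sub (memLp_const xs)).integrable_norm_pow two_ne_zero
  -- Every squared distance to a set containing `xs` is integrable.
  have hdist : ∀ C : Set (EuclideanSpace ℝ (Fin n)), IsClosed C → Convex ℝ C → xs ∈ C →
      Measurable[m] (fun ω => ‖X ω - proj C (X ω)‖ ^ 2) ∧
      Integrable (fun ω => ‖X ω - proj C (X ω)‖ ^ 2) ν := by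
    intro C hC hC' hxC
    have hmeas : Measurable[m] (fun ω => ‖X ω - proj C (X ω)‖ ^ 2) :=
      (((continuous_id.sub (continuous_proj ⟨xs, hxC⟩ hC hC')).norm.pow 2).measurable).comp hX
    refine ⟨hmeas, hV.mono' (hmeas.mono hm le_rfl).aestronglyMeasurable (ae_of_all _ fun ω => ?_)⟩
    rw [Real.norm_of_nonneg (by positivity)]
    exact pow_le_pow_left₀ (norm_nonneg _) ((proj_spec ⟨xs, hxC⟩ hC _).2 xs hxC) 2
  have hg := fun i => hdist (K i) (hcl i) (hcv i) (hxi i)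
  have hd := hdist (⋂ i, K i) (isClosed_iInter hcl) (convex_iInter hcv) hxs
  have hSm : ∀ i, MeasurableSet {ω | w ω = i} := fun i => hw (measurableSet_singleton i)
  have hsplit : (fun ω => ‖X ω - proj (K (w ω)) (X ω)‖ ^ 2)
      = fun ω => ∑ i, {ω | w ω = i}.indicator (fun ω => ‖X ω - proj (K i) (X ω)‖ ^ 2) ω := by
    funext ω
    rw [Finset.sum_eq_single (w ω)]
    · simp
    · intro i _ hi
      simp [Ne.symm hi]
    · simp
  have hind : ∀ i, Integrable
      ({ω | w ω = i}.indicator fun ω => ‖X ω - proj (K i) (X ω)‖ ^ 2) ν :=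
    fun i => (hg i).2.indicator (hSm i)
  refine ⟨hd.2, ?_, ?_⟩
  · rw [hsplit]
    exact integrable_finsetSum _ fun i _ => hind i
  rw [hsplit, integral_finsetSum _ fun i _ => hind i]
  calc p / η * ∫ ω, ‖X ω - proj (⋂ i, K i) (X ω)‖ ^ 2 ∂ν
      ≤ p / η * ∫ ω, η * ∑ i, ‖X ω - proj (K i) (X ω)‖ ^ 2 ∂ν := by
        refine mul_le_mul_of_nonneg_left (integral_mono hd.2
          ((integrable_finsetSum _ fun i _ => (hg i).2).const_mul η) fun ω => ?_) (by positivity)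
        refine (hreg (X ω)).trans (mul_le_mul_of_nonneg_left ?_ hη.le)
        exact Real.iSup_le (fun i => Finset.single_le_sum
          (f := fun i => ‖X ω - proj (K i) (X ω)‖ ^ 2) (fun j _ => by positivity)
          (Finset.mem_univ i)) (Finset.sum_nonneg fun j _ => by positivity)
    _ = ∑ i, p * ∫ ω, ‖X ω - proj (K i) (X ω)‖ ^ 2 ∂ν := by
        rw [integral_const_mul, integral_finsetSum _ fun i _ => (hg i).2, ← Finset.mul_sum]
        field_simp
    _ ≤ ∑ i, ∫ ω, {ω | w ω = i}.indicator (fun ω => ‖X ω - proj (K i) (X ω)‖ ^ 2) ω ∂ν := by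
        refine Finset.sum_le_sum fun i _ => ?_
        rw [integral_indicator (hSm i)]
        exact const_mul_integral_le_setIntegral hm hp (hp' i) (hg i).1
          (fun ω => by positivity) (hg i).2

theorem measurable_twoStep {α β : ℝ} (hcl : ∀ i, IsClosed (K i)) (hcv : ∀ i, Convex ℝ (K i))
    (hne : (⋂ i, K i).Nonempty) (hw : Measurable w) {f : Ω → EuclideanSpace ℝ (Fin n)}
    (hX : Measurable X) (hf : Measurable f) :
    Measurable fun ω => X ω - α • f ω
      - β • (X ω - α • f ω - proj (K (w ω)) (X ω - α • f ω)) := by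
  obtain ⟨y, hy⟩ := hne
  have h : Measurable fun q : Fin N × EuclideanSpace ℝ (Fin n) => proj (K q.1) q.2 :=
    measurable_from_prod_countable_right fun i =>
      (continuous_proj ⟨y, Set.mem_iInter.1 hy i⟩ (hcl i) (hcv i)).measurable
  have hz : Measurable fun ω => X ω - α • f ω := hX.sub (hf.const_smul α)
  exact hz.sub ((hz.sub (h.comp (hw.prodMk hz))).const_smul β)

/-- The expected squared distance to the solution after one step of the algorithm, started at an
`m`-measurable random point `X`. Here `p` bounds the conditional sampling probabilities of the
constraints from below, and `η` is the regularity constant. -/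
theorem integral_twoStep_le [IsFiniteMeasure ν] (hm : m ≤ mΩ)
    {Φ : EuclideanSpace ℝ (Fin n) → Ω → EuclideanSpace ℝ (Fin n)}
    {G : EuclideanSpace ℝ (Fin n) → EuclideanSpace ℝ (Fin n)} {L B μ η p α β : ℝ}
    (hcont : ∀ ω, Continuous fun x => Φ x ω) (hmeas : ∀ x, Measurable (Φ x)) (hL : 0 ≤ L)
    (hΦi : ∀ x y, Integrable (fun ω => ‖Φ x ω - Φ y ω‖ ^ 2) ν)
    (hΦ : ∀ x y C, MeasurableSet[m] C →
      ∫ ω in C, ‖Φ x ω - Φ y ω‖ ^ 2 ∂ν ≤ L ^ 2 * ‖x - y‖ ^ 2 * ν.real C)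
    (hxi : Integrable (fun ω => ‖Φ xs ω‖ ^ 2) ν)
    (hB : ∫ ω, ‖Φ xs ω‖ ^ 2 ∂ν ≤ B ^ 2 * ν.real Set.univ)
    (hG : ∀ x y, ‖G x - G y‖ ≤ L * ‖x - y‖)
    (hΦG : ∀ x C, MeasurableSet[m] C → ∫ ω in C, Φ x ω ∂ν = ν.real C • G x)
    (hcl : ∀ i, IsClosed (K i)) (hcv : ∀ i, Convex ℝ (K i)) (hxs : xs ∈ ⋂ i, K i) (hμ : 0 < μ)
    (hmono : ∀ x ∈ ⋂ i, K i, ∀ y ∈ ⋂ i, K i, μ * ‖x - y‖ ^ 2 ≤ ⟪G x - G y, x - y⟫)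
    (hsol : ∀ y ∈ ⋂ i, K i, 0 ≤ ⟪G xs, y - xs⟫) (hGB : ‖G xs‖ ≤ B)
    (hη : 0 < η) (hp : 0 < p)
    (hreg : ∀ x : EuclideanSpace ℝ (Fin n),
      ‖x - proj (⋂ i, K i) x‖ ^ 2 ≤ η * ⨆ i, ‖x - proj (K i) x‖ ^ 2)
    (hw : Measurable w)
    (hp' : ∀ i C, MeasurableSet[m] C → ENNReal.ofReal p * ν C ≤ ν (C ∩ {ω | w ω = i}))
    (hα : 0 < α) (hβ : 0 < β) (hβ2 : β < 2) (hX : Measurable[m] X) (hX2 : MemLp X 2 ν)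
    {X' : Ω → EuclideanSpace ℝ (Fin n)}
    (hX' : ∀ ω, X' ω = X ω - α • Φ (X ω) ω
      - β • (X ω - α • Φ (X ω) ω - proj (K (w ω)) (X ω - α • Φ (X ω) ω))) :
    MemLp X' 2 ν ∧
    ∫ ω, ‖X' ω - xs‖ ^ 2 ∂ν
      ≤ (1 + (4 * L ^ 2 * α ^ 2 + 32 * L ^ 2 / (p / η) * (α ^ 2 / (β * (2 - β))))
          - min μ (p / η / 8) * min α (β * (2 - β))) * ∫ ω, ‖X ω - xs‖ ^ 2 ∂ν
        + (4 * B ^ 2 * α ^ 2 + 8 * B ^ 2 / (p / η) * (α ^ 2 / (β * (2 - β))))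
          * ν.real Set.univ := by
  set K' := ⋂ i, K i with hK'
  have hne : K'.Nonempty := ⟨xs, hxs⟩
  have hcl' : IsClosed K' := isClosed_iInter hcl
  have hcv' : Convex ℝ K' := convex_iInter hcv
  set γ := β * (2 - β) with hγ
  have hγ0 : 0 < γ := mul_pos hβ (by linarith)
  have hc : 0 < p / η := div_pos hp hη
  have hΦX := memLp_two_randomField_comp hm hcont hmeas hL hΦi hΦ hxi hX hX2
  have hΦX2 := integral_norm_sq_randomField_comp_le hm hcont hmeas hL hΦi hΦ hxi hX hX2 hB
  obtain ⟨hGX, hinner⟩ :=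
    integral_inner_randomField_comp hm hcont hmeas hL hΦi hΦ hxi hX hX2 hG hΦG
  obtain ⟨hdi, hdwi, hdist⟩ := integral_dist_feasible_le hm hcl hcv hxs hη hp.le hreg hw hp' hX hX2
  have hXx : MemLp (fun ω => X ω - xs) 2 ν := hX2.sub (memLp_const xs)
  have hV : Integrable (fun ω => ‖X ω - xs‖ ^ 2) ν := hXx.integrable_norm_pow two_ne_zero
  have hΦn : Integrable (fun ω => ‖Φ (X ω) ω‖ ^ 2) ν := hΦX.integrable_norm_pow two_ne_zero
  have hΦI := integrable_inner_of_memLp_two hΦX hXx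
  have hGI := integrable_inner_of_memLp_two hGX hXx
  have hX'm : Measurable X' := by
    rw [funext hX']
    exact measurable_twoStep hcl hcv hne hw (hX.mono hm le_rfl)
      (measurable_randomField_comp hcont hmeas (hX.mono hm le_rfl))
  have hpt : ∀ ω, ‖X' ω - xs‖ ^ 2 ≤ ‖X ω - xs‖ ^ 2 - 2 * α * ⟪Φ (X ω) ω, X ω - xs⟫
      + 2 * α ^ 2 * ‖Φ (X ω) ω‖ ^ 2 - γ / 2 * ‖X ω - proj (K (w ω)) (X ω)‖ ^ 2 := by
    intro ω
    rw [hX' ω]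
    exact norm_twoStep_sub_sq_le (hcl _) (hcv _) hβ.le hβ2.le (Set.mem_iInter.1 hxs _) _ _
  have hi1 := hV.sub (hΦI.const_mul (2 * α))
  have hi2 := hi1.add (hΦn.const_mul (2 * α ^ 2))
  have hi3 := hi2.sub (hdwi.const_mul (γ / 2))
  have hX'i : Integrable (fun ω => ‖X' ω - xs‖ ^ 2) ν :=
    hi3.mono' ((hX'm.sub_const xs).norm.pow_const 2).aestronglyMeasurable
      (ae_of_all _ fun ω => by
        rw [Real.norm_of_nonneg (by positivity)]
        exact hpt ω)
  have hX'2 : MemLp X' 2 ν := by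
    have h : MemLp (fun ω => X' ω - xs) 2 ν :=
      (memLp_two_iff_integrable_sq_norm (hX'm.sub_const xs).aestronglyMeasurable).2 hX'i
    refine (h.add (memLp_const xs)).ae_eq (ae_of_all _ fun ω => ?_)
    simp
  refine ⟨hX'2, ?_⟩
  have h1 : ∫ ω, ‖X' ω - xs‖ ^ 2 ∂ν ≤ ∫ ω, ‖X ω - xs‖ ^ 2 ∂ν
      - 2 * α * ∫ ω, ⟪G (X ω), X ω - xs⟫ ∂ν + 2 * α ^ 2 * ∫ ω, ‖Φ (X ω) ω‖ ^ 2 ∂ν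
      - γ / 2 * ∫ ω, ‖X ω - proj (K (w ω)) (X ω)‖ ^ 2 ∂ν := by
    refine (integral_mono hX'i hi3 hpt).trans_eq ?_
    rw [← hinner, integral_sub' hi2 (hdwi.const_mul (γ / 2)),
      integral_add' hi1 (hΦn.const_mul (2 * α ^ 2)), integral_sub' hV (hΦI.const_mul (2 * α)),
      integral_const_mul, integral_const_mul, integral_const_mul]
  have h2 : ∫ ω, ‖X ω - xs‖ ^ 2 ∂ν - 2 * α * ∫ ω, ⟪G (X ω), X ω - xs⟫ ∂ν
      - γ * (p / η) / 2 * ∫ ω, ‖X ω - proj K' (X ω)‖ ^ 2 ∂ν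
      ≤ (1 + 32 * L ^ 2 / (p / η) * (α ^ 2 / γ) - min μ (p / η / 8) * min α γ)
          * ∫ ω, ‖X ω - xs‖ ^ 2 ∂ν
        + 8 * B ^ 2 / (p / η) * (α ^ 2 / γ) * ν.real Set.univ := by
    have hj1 := hV.sub (hGI.const_mul (2 * α))
    have hj2 := hj1.sub (hdi.const_mul (γ * (p / η) / 2))
    have hj3 : Integrable (fun ω =>
        (1 + 32 * L ^ 2 / (p / η) * (α ^ 2 / γ) - min μ (p / η / 8) * min α γ) * ‖X ω - xs‖ ^ 2
          + 8 * B ^ 2 / (p / η) * (α ^ 2 / γ)) ν := (hV.const_mul _).add (integrable_const _)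
    have h := integral_mono hj2 hj3 fun ω => by
      refine descent_le hμ hα hγ0 hc
        (inner_sub_solution_ge hne hcl' hG hcv' hmono hxs hsol hGB hL (X ω)) ?_
      have h' := norm_sub_sq_le_two_mul (proj K' (X ω) - xs) (proj K' (X ω) - X ω)
      rw [sub_sub_sub_cancel_left] at h'
      rwa [norm_sub_rev (X ω) (proj K' (X ω))]
    rw [integral_sub' hj1 (hdi.const_mul _), integral_sub' hV (hGI.const_mul _),
      integral_add (hV.const_mul _) (integrable_const _), integral_const_mul, integral_const_mul,
      integral_const_mul, integral_const, smul_eq_mul] at h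
    linarith
  have h3 := mul_le_mul_of_nonneg_left hdist hγ0.le
  have h4 := mul_le_mul_of_nonneg_left hΦX2 (sq_nonneg α)
  linarith

end StepBound

/-! ### Conditional expectations and set integrals -/

section CondExp

variable {Ω : Type*} {m mΩ : MeasurableSpace Ω} {P : Measure Ω} [IsFiniteMeasure P]

theorem setIntegral_le_of_condExp_le (hm : m ≤ mΩ) {f : Ω → ℝ} (hf : Integrable f P) {c : ℝ}
    (h : ∀ᵐ ω ∂P, (P[f|m]) ω ≤ c) {C : Set Ω} (hC : MeasurableSet[m] C) :
    ∫ ω in C, f ω ∂P ≤ c * P.real C := by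
  rw [← setIntegral_condExp hm hf hC]
  refine (setIntegral_mono_ae integrable_condExp.integrableOn
    (integrable_const c).integrableOn h).trans_eq ?_
  rw [setIntegral_const, smul_eq_mul, mul_comm]

theorem le_setIntegral_of_le_condExp (hm : m ≤ mΩ) {f : Ω → ℝ} (hf : Integrable f P) {c : ℝ}
    (h : ∀ᵐ ω ∂P, c ≤ (P[f|m]) ω) {C : Set Ω} (hC : MeasurableSet[m] C) :
    c * P.real C ≤ ∫ ω in C, f ω ∂P := by
  rw [← setIntegral_condExp hm hf hC]
  refine Eq.trans_le ?_ (setIntegral_mono_ae (integrable_const c).integrableOn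
    integrable_condExp.integrableOn h)
  rw [setIntegral_const, smul_eq_mul, mul_comm]

theorem setIntegral_eq_of_condExp_eq {F : Type*} [NormedAddCommGroup F] [NormedSpace ℝ F]
    [CompleteSpace F] (hm : m ≤ mΩ) {f : Ω → F} (hf : Integrable f P) {c : F}
    (h : ∀ᵐ ω ∂P, (P[f|m]) ω = c) {C : Set Ω} (hC : MeasurableSet[m] C) :
    ∫ ω in C, f ω ∂P = P.real C • c := by
  rw [← setIntegral_condExp hm hf hC, setIntegral_congr_ae (hm C hC) (h.mono fun ω hω _ => hω),
    setIntegral_const]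

theorem ofReal_mul_measure_le_of_le_condExp (hm : m ≤ mΩ) {S : Set Ω} (hS : MeasurableSet S)
    {c : ℝ} (hc : 0 ≤ c) (h : ∀ᵐ ω ∂P, c ≤ (P[S.indicator fun _ => (1 : ℝ)|m]) ω) {C : Set Ω}
    (hC : MeasurableSet[m] C) : ENNReal.ofReal c * P C ≤ P (C ∩ S) := by
  have h1 := le_setIntegral_of_le_condExp hm ((integrable_const (1 : ℝ)).indicator hS) h hC
  rw [setIntegral_indicator hS, setIntegral_const, smul_eq_mul, mul_one] at h1
  rw [← ofReal_measureReal (s := C), ← ofReal_measureReal (s := C ∩ S),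
    ← ENNReal.ofReal_mul hc]
  exact ENNReal.ofReal_le_ofReal h1

end CondExp

/-! ### The history of the algorithm -/

namespace CausalVI

variable {n N : ℕ} {ι : Type*} {R : ι → Type*} {U : Type*}
  [∀ i, MeasurableSpace (R i)] [MeasurableSpace U] (M : CausalVI n N ι R U)
  {Ω : Type*} (α β : ℕ → ℝ) (v : ℕ → Ω → U × ∀ i, R i) (w : ℕ → Ω → Fin N)
  (x₀ : Ω → EuclideanSpace ℝ (Fin n))

theorem measurable_iterate_history (k : ℕ) :
    Measurable[M.history α β v w x₀ k] (M.iterate α β v w x₀ k) :=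
  Measurable.of_comap_le <| le_sup_of_le_right <|
    le_iSup₂_of_le (f := fun j (_ : j ≤ k) =>
      MeasurableSpace.comap (M.iterate α β v w x₀ j) inferInstance) k le_rfl le_rfl

theorem history_mono : Monotone (M.history α β v w x₀) := by
  intro k l hkl
  refine sup_le_sup (sup_le_sup (sup_le_sup ?_ ?_) ?_) ?_
  · exact biSup_mono fun j hj => hj.trans_le hkl
  · exact biSup_mono fun j hj => hj.trans_le hkl
  · exact biSup_mono fun j hj => hj.trans_le hkl
  · exact biSup_mono fun j hj => hj.trans hkl

variable {α β v w x₀} [mΩ : MeasurableSpace Ω]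

theorem measurable_field_comp (hv : ∀ k, Measurable (v k)) (k : ℕ)
    {X : Ω → EuclideanSpace ℝ (Fin n)} (hX : Measurable X) :
    Measurable fun ω => M.field (X ω) (v k ω) :=
  measurable_randomField_comp (Φ := fun x ω => M.field x (v k ω))
    (fun ω => M.continuous_field (v k ω)) (fun x => (M.measurable_field x).comp (hv k)) hX

theorem measurable_iterate (hv : ∀ k, Measurable (v k)) (hw : ∀ k, Measurable (w k))
    (hx₀ : Measurable x₀) (k : ℕ) : Measurable (M.iterate α β v w x₀ k) := by
  induction k with
  | zero => exact hx₀
  | succ k ih =>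
    exact measurable_twoStep M.isClosed_constraint M.convex_constraint M.nonempty_feasible (hw k)
      ih (M.measurable_field_comp hv k ih)

theorem history_le (hv : ∀ k, Measurable (v k)) (hw : ∀ k, Measurable (w k))
    (hx₀ : Measurable x₀) (k : ℕ) : M.history α β v w x₀ k ≤ mΩ := by
  have hx := M.measurable_iterate (α := α) (β := β) hv hw hx₀
  refine sup_le (sup_le (sup_le ?_ ?_) ?_) ?_
  · exact iSup₂_le fun j _ => (hv j).comap_le
  · exact iSup₂_le fun j _ => (hw j).comap_le
  · exact iSup₂_le fun j _ =>
      ((hx j).sub ((M.measurable_field_comp hv j (hx j)).const_smul (α j))).comap_le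
  · exact iSup₂_le fun j _ => (hx j).comap_le

/-- The mean field inherits the Lipschitz constant of the sampled field, by Jensen's inequality. -/
theorem norm_meanField_sub_le {a : Intervention R} {Pr : Measure Ω} [IsProbabilityMeasure Pr]
    {m : MeasurableSpace Ω} (hm : m ≤ mΩ) {u : Ω → U × ∀ i, R i} {L : ℝ} (hL : 0 ≤ L)
    (hlip : ∀ x y, Integrable (fun ω => ‖M.field x (u ω) - M.field y (u ω)‖ ^ 2) Pr ∧
      ∀ᵐ ω ∂Pr, (Pr[fun ω' => ‖M.field x (u ω') - M.field y (u ω')‖ ^ 2 | m]) ω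
        ≤ L ^ 2 * ‖x - y‖ ^ 2)
    (hunb : ∀ x, Integrable (fun ω => M.field x (u ω)) Pr ∧
      ∀ᵐ ω ∂Pr, (Pr[fun ω' => M.field x (u ω') | m]) ω = M.meanField a x)
    (x y : EuclideanSpace ℝ (Fin n)) :
    ‖M.meanField a x - M.meanField a y‖ ≤ L * ‖x - y‖ := by
  have hE : ∀ x, ∫ ω, M.field x (u ω) ∂Pr = M.meanField a x := fun x => by
    have h := setIntegral_eq_of_condExp_eq hm (hunb x).1 (hunb x).2 MeasurableSet.univ
    simpa using h
  have hd : Integrable (fun ω => ‖M.field x (u ω) - M.field y (u ω)‖) Pr :=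
    ((hunb x).1.sub (hunb y).1).norm
  have h1 : ‖M.meanField a x - M.meanField a y‖
      ≤ ∫ ω, ‖M.field x (u ω) - M.field y (u ω)‖ ∂Pr := by
    rw [← hE x, ← hE y, ← integral_sub (hunb x).1 (hunb y).1]
    exact norm_integral_le_integral_norm _
  have h2 : (∫ ω, ‖M.field x (u ω) - M.field y (u ω)‖ ∂Pr) ^ 2
      ≤ ∫ ω, ‖M.field x (u ω) - M.field y (u ω)‖ ^ 2 ∂Pr :=
    (convexOn_pow 2).map_integral_le (continuous_pow 2).continuousOn isClosed_Ici
      (ae_of_all _ fun ω => norm_nonneg _) hd (hlip x y).1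
  have h3 := setIntegral_le_of_condExp_le hm (hlip x y).1 (hlip x y).2 MeasurableSet.univ
  rw [setIntegral_univ, probReal_univ, mul_one, ← mul_pow] at h3
  refine h1.trans (le_of_sq_le_sq (h2.trans h3) (by positivity))

end CausalVI

/-! ### Convergence -/

theorem StepSizes.tendsto_sum_min {α β : ℕ → ℝ} (h : StepSizes α β) {κ : ℝ} (hκ : 0 < κ) :
    Tendsto (fun N => ∑ k ∈ Finset.range N, κ * min (α k) (β k * (2 - β k))) atTop atTop := by
  have hγ : ∀ k, 0 < β k * (2 - β k) := fun k =>
    mul_pos (h.β_pos k) (by linarith [h.β_lt_two k])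
  -- Where `γ k < α k` one has `α k ≤ α k ^ 2 / γ k`, and these terms have a finite sum.
  have hle : ∀ k, α k - α k ^ 2 / (β k * (2 - β k)) ≤ min (α k) (β k * (2 - β k)) := by
    intro k
    have hα := h.α_pos k
    have h0 : 0 ≤ α k ^ 2 / (β k * (2 - β k)) := div_nonneg (sq_nonneg _) (hγ k).le
    rcases le_total (α k) (β k * (2 - β k)) with hk | hk
    · rw [min_eq_left hk]
      linarith
    · rw [min_eq_right hk]
      have : α k ≤ α k ^ 2 / (β k * (2 - β k)) := by
        rw [le_div_iff₀ (hγ k), sq]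
        exact mul_le_mul_of_nonneg_left hk hα.le
      linarith [hγ k]
  have hlim : Tendsto (fun N => ∑ k ∈ Finset.range N, α k
      + -(∑' k, α k ^ 2 / (β k * (2 - β k)))) atTop atTop :=
    tendsto_atTop_add_const_right _ _ h.sum_α
  simp only [← Finset.mul_sum]
  refine (tendsto_atTop_mono (fun N => ?_) hlim).const_mul_atTop hκ
  have h1 := h.sum_α_sq_div.sum_le_tsum (Finset.range N) fun k _ =>
    div_nonneg (sq_nonneg (α k)) (hγ k).le
  have h2 := Finset.sum_le_sum fun k (_ : k ∈ Finset.range N) => hle k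
  rw [Finset.sum_sub_distrib] at h2
  linarith

theorem mainTheorem2
    {n m : ℕ} {ι : Type*} {R : ι → Type*} {U : Type*}
    [∀ i, MeasurableSpace (R i)] [MeasurableSpace U]
    (M : CausalVI n m ι R U) (a : Intervention R)
    {Ω : Type*} [MeasurableSpace Ω] (Pr : Measure Ω) [IsProbabilityMeasure Pr]
    (α β : ℕ → ℝ) (v : ℕ → Ω → U × ∀ i, R i) (w : ℕ → Ω → Fin m)
    (x₀ : Ω → EuclideanSpace ℝ (Fin n))
    (hv : ∀ k, Measurable (v k)) (hw : ∀ k, Measurable (w k)) (hx₀ : Measurable x₀)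
    (hmean : M.HasMeanField a)
    (hmono : M.StronglyMonotone a)
    (hlip : M.StochasticLipschitz Pr (M.history α β v w x₀) v)
    (hbdd : M.BoundedAtSolution a Pr (M.history α β v w x₀) v)
    (hreg : M.LinearlyRegular)
    (hstep : StepSizes α β)
    (hsamp : SufficientSampling Pr (M.history α β v w x₀) w)
    (hunb : M.UnbiasedSampling a Pr (M.history α β v w x₀) v) :
    ∃ xs : EuclideanSpace ℝ (Fin n), (∀ y, M.IsSolution a y ↔ y = xs) ∧
      ∀ᵐ ω ∂Pr, Tendsto (fun k => M.iterate α β v w x₀ k ω) atTop (𝓝 xs) := by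
  obtain ⟨L, hL, hlip⟩ := hlip
  obtain ⟨μ, hμ, hmono⟩ := hmono
  obtain ⟨η, hη, hreg⟩ := hreg
  obtain ⟨ρ, hρ, -, hsamp⟩ := hsamp
  have hle := M.history_le (α := α) (β := β) hv hw hx₀
  have hG := M.norm_meanField_sub_le (a := a) (hle 0) hL.le (hlip 0) (hunb 0)
  obtain ⟨xs, hxs, hsol⟩ := exists_variationalInequality_solution M.nonempty_feasible
    (isClosed_iInter M.isClosed_constraint) (convex_iInter M.convex_constraint) hG hμ hmono
  refine ⟨xs, fun y => ⟨fun hy => variationalInequality_solution_unique hμ hmono hy.1 hy.2 hxs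
    hsol, fun hy => hy ▸ ⟨hxs, hsol⟩⟩, ?_⟩
  obtain ⟨B, -, hGB, hbdd⟩ := hbdd xs ⟨hxs, hsol⟩
  -- A point of `Ω` provides an index of a constraint, so there is at least one constraint.
  have hm0 : 0 < m := by
    obtain ⟨ω⟩ := Measure.nonempty_of_neZero Pr
    exact (w 0 ω).pos
  have hp : 0 < ρ / m := div_pos hρ (Nat.cast_pos.2 hm0)
  have hγ : ∀ k, 0 < β k * (2 - β k) := fun k =>
    mul_pos (hstep.β_pos k) (by linarith [hstep.β_lt_two k])
  set x := M.iterate α β v w x₀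
  have hxm : ∀ k, Measurable[M.history α β v w x₀ k] (x k) :=
    M.measurable_iterate_history α β v w x₀
  let ℱ : Filtration ℕ ‹MeasurableSpace Ω› := ⟨M.history α β v w x₀, M.history_mono α β v w x₀, hle⟩
  set A : ℕ → Set Ω := fun r => {ω | ‖x₀ ω‖ ≤ r}
  have hAm : ∀ r k, MeasurableSet[M.history α β v w x₀ k] (A r) := fun r k =>
    M.history_mono α β v w x₀ (Nat.zero_le k) _
      ((measurable_norm.comp (hxm 0)) measurableSet_Iic)
  -- The recursion on every event of the past on which `x k` is square-integrable.
  have hrec : ∀ k C, MeasurableSet[M.history α β v w x₀ k] C → MemLp (x k) 2 (Pr.restrict C) →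
      MemLp (x (k + 1)) 2 (Pr.restrict C) ∧
      ∫ ω in C, ‖x (k + 1) ω - xs‖ ^ 2 ∂Pr
        ≤ (1 + (4 * L ^ 2 * α k ^ 2
              + 32 * L ^ 2 / (ρ / m / η) * (α k ^ 2 / (β k * (2 - β k))))
            - min μ (ρ / m / η / 8) * min (α k) (β k * (2 - β k)))
              * ∫ ω in C, ‖x k ω - xs‖ ^ 2 ∂Pr
          + (4 * B ^ 2 * α k ^ 2 + 8 * B ^ 2 / (ρ / m / η) * (α k ^ 2 / (β k * (2 - β k))))
            * Pr.real C := by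
    intro k C hC hXC
    have hres : ∀ D, MeasurableSet[M.history α β v w x₀ k] D →
        (Pr.restrict C).restrict D = Pr.restrict (D ∩ C) ∧
        (Pr.restrict C).real D = Pr.real (D ∩ C) := fun D hD =>
      ⟨Measure.restrict_restrict (hle k D hD),
        measureReal_restrict_apply (hle k D hD)⟩
    have h := integral_twoStep_le (ν := Pr.restrict C) (K := M.constraint) (w := w k) (X := x k)
      (X' := x (k + 1)) (xs := xs) (B := B) (μ := μ) (η := η) (p := ρ / m) (α := α k) (β := β k)
      (Φ := fun y ω => M.field y (v k ω)) (G := M.meanField a) (hle k)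
      (fun ω => M.continuous_field _) (fun y => (M.measurable_field y).comp (hv k)) hL.le
      (fun y z => (hlip k y z).1.integrableOn)
      (fun y z D hD => by
        rw [(hres D hD).1, (hres D hD).2]
        exact setIntegral_le_of_condExp_le (hle k) (hlip k y z).1 (hlip k y z).2 (hD.inter hC))
      (hbdd k).1.integrableOn
      (by
        rw [measureReal_restrict_apply_univ]
        exact setIntegral_le_of_condExp_le (hle k) (hbdd k).1 (hbdd k).2 hC)
      hG
      (fun y D hD => by
        rw [(hres D hD).1, (hres D hD).2]
        exact setIntegral_eq_of_condExp_eq (hle k) (hunb k y).1 (hunb k y).2 (hD.inter hC))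
      M.isClosed_constraint M.convex_constraint hxs hμ hmono hsol hGB hη hp hreg (hw k)
      (fun i D hD => by
        have hS : MeasurableSet {ω | w k ω = i} := hw k (measurableSet_singleton i)
        rw [Measure.restrict_apply (hle k D hD), Measure.restrict_apply ((hle k D hD).inter hS),
          Set.inter_right_comm]
        exact ofReal_mul_measure_le_of_le_condExp (hle k) hS hp.le (hsamp k i) (hD.inter hC))
      (hstep.α_pos k) (hstep.β_pos k) (hstep.β_lt_two k) (hxm k) hXC (fun ω => rfl)
    rwa [measureReal_restrict_apply_univ] at h
  have hmem : ∀ r k, MemLp (x k) 2 (Pr.restrict (A r)) := by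
    intro r k
    induction k with
    | zero =>
      refine MemLp.of_bound hx₀.aestronglyMeasurable r ?_
      exact (ae_restrict_iff' (hle 0 _ (hAm r 0))).2 (ae_of_all _ fun ω hω => hω)
    | succ k ih => exact (hrec k _ (hAm r k) ih).1
  have hconv : ∀ r : ℕ, ∀ᵐ ω ∂Pr,
      Tendsto (fun k => (A r).indicator (fun ω => ‖x k ω - xs‖ ^ 2) ω) atTop (𝓝 0) := by
    intro r
    refine ae_tendsto_zero_of_setIntegral_le ℱ
      (V := fun k => (A r).indicator fun ω => ‖x k ω - xs‖ ^ 2)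
      (a := fun k => 4 * L ^ 2 * α k ^ 2
        + 32 * L ^ 2 / (ρ / m / η) * (α k ^ 2 / (β k * (2 - β k))))
      (b := fun k => 4 * B ^ 2 * α k ^ 2
        + 8 * B ^ 2 / (ρ / m / η) * (α k ^ 2 / (β k * (2 - β k))))
      (θ := fun k => min μ (ρ / m / η / 8) * min (α k) (β k * (2 - β k)))
      (fun k => ?_) (fun k => ?_) (fun k ω => ?_) (fun k => ?_) (fun k => ?_) (fun k => ?_)
      ?_ ?_ ?_ fun k s hs => ?_
    · have hc : Continuous fun y : EuclideanSpace ℝ (Fin n) => ‖y - xs‖ ^ 2 := by fun_prop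
      have h : Measurable[M.history α β v w x₀ k]
          ((A r).indicator fun ω => ‖x k ω - xs‖ ^ 2) :=
        (hc.measurable.comp (hxm k)).indicator (hAm r k)
      exact h.stronglyMeasurable
    · rw [integrable_indicator_iff (hle k _ (hAm r k))]
      exact ((hmem r k).sub (memLp_const xs)).integrable_norm_pow two_ne_zero
    · exact Set.indicator_nonneg (fun ω _ => by positivity) ω
    · have := hγ k
      positivity
    · have := hγ k
      positivity
    · have := hγ k
      have := hstep.α_pos k
      positivity
    · exact (hstep.sum_α_sq.mul_left _).add (hstep.sum_α_sq_div.mul_left _)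
    · exact (hstep.sum_α_sq.mul_left _).add (hstep.sum_α_sq_div.mul_left _)
    · exact hstep.tendsto_sum_min (lt_min hμ (by positivity))
    · have hsA : MeasurableSet[M.history α β v w x₀ k] (s ∩ A r) :=
        MeasurableSet.inter hs (hAm r k)
      have h := (hrec k _ hsA ((hmem r k).mono_measure
        (Measure.restrict_mono Set.inter_subset_right le_rfl))).2
      rw [setIntegral_indicator (hle k _ (hAm r k)), setIntegral_indicator (hle k _ (hAm r k))]
      refine h.trans (add_le_add_right (mul_le_mul_of_nonneg_left
        (measureReal_mono Set.inter_subset_left) ?_) _)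
      have := hγ k
      positivity
  filter_upwards [ae_all_iff.2 hconv] with ω hω
  obtain ⟨r, hr⟩ := exists_nat_ge ‖x₀ ω‖
  have h1 := hω r
  simp only [Set.indicator_of_mem (show ω ∈ A r from hr)] at h1
  rw [tendsto_iff_norm_sub_tendsto_zero]
  have h2 := h1.sqrt
  simpa [Real.sqrt_sq] using h2

end
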